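/- Consider a single-server $G/G/1$ queue, started at time $0$ with an arrival to an empty system, with i.i.d. nonnegative interarrival times distributed as $U$ and, independent of them, i.i.d. nonnegative service times distributed as $S$, where $\mathbb{E}U^3,\mathbb{E}S^3<\infty$. Let $\lambda=1/\mathbb{E}U$ and $\rho=\lambda\,\mathbb{E}S<1$. Let $V(t)$ be the workload at time $t$, and let $X$ have the limiting (steady-state) distribution of $X(t)=(1-\rho)V(t)$ as $t\to\infty$. Let $Y$ be exponentially distributed with rate $2/(\lambda\,\mathbb{E}(U-S)^2)$, where $U$ and $S$ are independent. Suppose that $U$ has a density $g$ and let $\eta(x)=g(x)/\mathbb{P}(U>x)$, $x\ge 0$, be its hazard rate, $\overline\eta=\sup_{x\ge0}\eta(x)$ and $\underline\eta=\inf_{x\ge0}\eta(x)$. Let $\mathcal M_3$ be the set of $h:\mathbb{R}\to\mathbb{R}$ whose derivatives of orders $1,2,3$ exist and are bounded by $1$ in absolute value. (a) If $\eta$ is nonincreasing on $[0,\infty)$ and $\overline\eta=\eta(0)<\infty$, then $\mathbb{E}X<\infty$ and $$|\mathbb{E}X-\mathbb{E}Y|\le(1-\rho)\,\overline C_3,$$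 and, if also $\mathbb{E}S^4<\infty$, $$\sup_{h\in\mathcal M_3}|\mathbb{E}h(X)-\mathbb{E}h(Y)|\le(1-\rho)\,\overline C_3'+(1-\rho)^2\,\overline C_4'.$$ Here $\overline C_3,\overline C_3'$ are functions of $\overline\eta$ and the first three moments of $U$ and $S$ only, and $\overline C_4'$ is a function of $\overline\eta$, the first three moments of $U$ and the first four moments of $S$ only. (b) If $\overline\eta<\infty$ and $\underline\eta>0$, then the same bounds hold with constants $\underline C_3,\underline C_3',\underline C_4'$, where $\underline C_3,\underline C_3'$ are functions of $\overline\eta,\underline\eta$ and the first three moments of $U$ and $S$ only, and $\underline C_4'$ is a function of $\overline\eta,\underline\eta$, the first three moments of $U$ and the first four moments of $S$ only. In both cases the constants are continuous functions of these arguments on the set where all arguments are positive; in particular they stay bounded as $\rho\uparrow1$ while the arguments converge to positive limits. -/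

import Mathlib

open MeasureTheory ProbabilityTheory Filter Topology

namespace GG1

/-- The primitives of a `G/G/1` queue that starts at time `0` with an arrival to an empty system:
customer `n` brings the work `S n`, and `U n` is the time between the arrivals of the customers
`n` and `n + 1`. All these variables are independent, the `U n` have a common law, the `S n` have
a common law, they are nonnegative and have finite third moments. -/
structure IsQueue {Ω : Type*} [MeasurableSpace Ω] (P : Measure Ω) (U S : ℕ → Ω → ℝ) : Prop where
  measurable_U : ∀ n, Measurable (U n)
  measurable_S : ∀ n, Measurable (S n)
  indep : iIndepFun (Sum.elim U S) P
  ident_U : ∀ n, IdentDistrib (U n) (U 0) P P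
  ident_S : ∀ n, IdentDistrib (S n) (S 0) P P
  nonneg_U : ∀ n, ∀ᵐ ω ∂P, 0 ≤ U n ω
  nonneg_S : ∀ n, ∀ᵐ ω ∂P, 0 ≤ S n ω
  integrable_U : Integrable (fun ω => U 0 ω ^ 3) P
  integrable_S : Integrable (fun ω => S 0 ω ^ 3) P

section Workload

variable {Ω : Type*} (U S : ℕ → Ω → ℝ)

/-- The arrival time of customer `n`; customer `0` arrives at time `0`. -/
def arrivalTime (n : ℕ) (ω : Ω) : ℝ := ∑ i ∈ Finset.range n, U i ω

/-- The work in the system immediately after the arrival of customer `n`; the server works at unit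
rate between arrivals. -/
def workAfterArrival (ω : Ω) : ℕ → ℝ
  | 0 => S 0 ω
  | n + 1 => max (workAfterArrival ω n - U n ω) 0 + S (n + 1) ω

/-- The last customer that arrived up to time `t`. -/
noncomputable def lastArrival (t : ℝ) (ω : Ω) : ℕ := sSup {n : ℕ | arrivalTime U n ω ≤ t}

/-- The workload `V(t)` in the system at time `t ≥ 0`. -/
noncomputable def workload (t : ℝ) (ω : Ω) : ℝ :=
  max (workAfterArrival U S ω (lastArrival U t ω)
    - (t - arrivalTime U (lastArrival U t ω) ω)) 0

variable [MeasurableSpace Ω] (P : Measure Ω)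

/-- The arrival rate `λ = 1 / E U`. -/
noncomputable def arrivalRate : ℝ := 1 / ∫ ω, U 0 ω ∂P

/-- The utilization `ρ = λ E S`. -/
noncomputable def utilization : ℝ := arrivalRate U P * ∫ ω, S 0 ω ∂P

/-- The scaled workload `X(t) = (1 - ρ) V(t)`. -/
noncomputable def scaledWorkload (t : ℝ) (ω : Ω) : ℝ :=
  (1 - utilization U S P) * workload U S t ω

/-- The rate `2 / (λ E (U - S)²)` of the approximating exponential distribution. -/
noncomputable def expRate : ℝ :=
  2 / (arrivalRate U P * ∫ ω, (U 0 ω - S 0 ω) ^ 2 ∂P)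

end Workload

/-- `g` is a density of the law of the real random variable `T`. -/
structure IsDensity {Ω : Type*} [MeasurableSpace Ω] (P : Measure Ω) (T : Ω → ℝ) (g : ℝ → ℝ) :
    Prop where
  measurable : Measurable g
  nonneg : ∀ x, 0 ≤ g x
  map_eq : P.map T = volume.withDensity (fun x => ENNReal.ofReal (g x))

section Hazard

variable {Ω : Type*} [MeasurableSpace Ω] (P : Measure Ω) (T : Ω → ℝ) (g : ℝ → ℝ)

/-- The hazard rate `η(x) = g(x) / (1 - G(x))` with `G(x) = P(T ≤ x)`. -/
noncomputable def hazardRate (x : ℝ) : ℝ := g x / (1 - P.real {ω | T ω ≤ x})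

/-- The supremum of the hazard rate over `[0, ∞)`. -/
noncomputable def hazardSup : ℝ := sSup (hazardRate P T g '' Set.Ici 0)

/-- The infimum of the hazard rate over `[0, ∞)`. -/
noncomputable def hazardInf : ℝ := sInf (hazardRate P T g '' Set.Ici 0)

end Hazard

/-- The first `k` moments `E T, …, E T ^ k` of `T`. -/
noncomputable def moments {Ω : Type*} [MeasurableSpace Ω] (P : Measure Ω) (T : Ω → ℝ) (k : ℕ) :
    Fin k → ℝ := fun i => moment T (i.val + 1) P

/-- The class `M_k` of functions whose derivatives of the orders `1, …, k` exist and are bounded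
by `1` in absolute value. -/
def smoothClass (k : ℕ) : Set (ℝ → ℝ) :=
  {h | (∀ j < k, Differentiable ℝ (iteratedDeriv j h)) ∧
    ∀ j, 1 ≤ j → j ≤ k → ∀ x, |iteratedDeriv j h x| ≤ 1}

/-- The standing assumptions: a `G/G/1` queue with utilization below `1`, whose interarrival time
has the density `g` with a hazard rate that is bounded above, and a random variable `X` that has
the limiting distribution of the scaled workload as time tends to infinity. -/
structure Setting {Ω Ω' : Type*} [MeasurableSpace Ω] [MeasurableSpace Ω']
    (P : Measure Ω) [IsProbabilityMeasure P] (P' : Measure Ω') [IsProbabilityMeasure P']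
    (U S : ℕ → Ω → ℝ) (g : ℝ → ℝ) (X : Ω' → ℝ) : Prop where
  isQueue : IsQueue P U S
  utilization_lt_one : utilization U S P < 1
  isDensity : IsDensity P (U 0) g
  bddAbove_hazardRate : BddAbove (hazardRate P (U 0) g '' Set.Ici 0)
  limit_law : TendstoInDistribution (scaledWorkload U S P) atTop X (fun _ : ℝ => P) P'

end GG1

/-! Stein's method for the exponential law, carried out on averages over the first n customers, so
that no stationary version of the queue has to be built. Write a = E U, b = E S, δ = 1 - ρ, ξ_k =
S_k - U_k, c = E(U - S)²/(2a) = E Y, W_k for the waiting times and I_k for the idle times. For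
bounded smooth h the function γ(x) = E h(Y) - E h(x + Y) satisfies γ(0) = 0 and c γ' - γ = h - E
h(Y) (`stein_equation`). With f = c γ' - γ, the task is therefore to show that E f(X) is O(δ).

The time integral of f(δ V) over the first n interarrival times, divided by n, tends in mean to a E
f(X) (`IsQueue.tendsto_average_workload`). Between arrivals the workload falls at unit rate, so
these integrals are explicit and telescope. Up to O(δ) per customer they leave b E f(δ W_k) from the
upward jumps and c γ'(0) E I_k from the idle periods (`IsQueue.abs_sum_integral_depletion_le`). The
first term is handled by a Taylor expansion of Γ(v) = ∫₀^v γ(δ x) dx along the recursion W_{k+1} =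
max(W_k + ξ_k, 0). Since E ξ = -aδ and E ξ² = 2ac, the mean increment of Γ(W_k) is aδ E f(δ W_k),
with an error of order δ² + δ E I_k² (`IsQueue.abs_integral_scaledPrimitive_sub_le`). Since E W_n =
o(n), boundary terms disappear on division by n, and Σ E I_k = E W_n + n a δ shows that idle time
accrues at rate aδ per customer. So E f(X) = O(δ) follows from an estimate Σ E I_k² ≤ K Σ E I_k.

The hazard rate enters only in that estimate (`IsQueue.sum_integral_idleTime_sq_le`). Idling
requires W_k ≤ U_k, and the expected number H(x) of customers with W_k ≤ x grows at most linearly: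
H(x) ≤ (x + 1) H(1). Conversely, W_k ≤ 1 forces idling of length at least 1 with a probability
bounded below, because P(U > x) ≥ exp(-x sup η).

Unbounded h are reached by smooth truncation with arctan. The same argument applied to √(1 + x²)
gives E X < ∞. -/

namespace GG1

/-! ### The recursion for the waiting times -/

section Chain

variable {Ω : Type*} {U S : ℕ → Ω → ℝ}

/-- The waiting time of customer `n`: the work found in the system on arrival. -/
def waitingTime (U S : ℕ → Ω → ℝ) (n : ℕ) (ω : Ω) : ℝ := workAfterArrival U S ω n - S n ω

/-- The idle time of the server between the arrivals of the customers `n` and `n + 1`. -/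
noncomputable def idleTime (U S : ℕ → Ω → ℝ) (n : ℕ) (ω : Ω) : ℝ :=
  max (U n ω - S n ω - waitingTime U S n ω) 0

lemma workAfterArrival_eq (n : ℕ) (ω : Ω) :
    workAfterArrival U S ω n = waitingTime U S n ω + S n ω := by
  simp [waitingTime]

@[simp] lemma waitingTime_zero (ω : Ω) : waitingTime U S 0 ω = 0 := by
  simp [waitingTime, workAfterArrival]

lemma waitingTime_succ (n : ℕ) (ω : Ω) :
    waitingTime U S (n + 1) ω = max (waitingTime U S n ω + (S n ω - U n ω)) 0 := by
  simp [waitingTime, workAfterArrival]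

/-- The idle time is the reflection term of the recursion. In this additive form its mean can be
found by telescoping. -/
lemma waitingTime_succ_eq_add_idleTime (n : ℕ) (ω : Ω) :
    waitingTime U S (n + 1) ω
      = waitingTime U S n ω + (S n ω - U n ω) + idleTime U S n ω := by
  rw [waitingTime_succ, idleTime]
  rcases le_total (waitingTime U S n ω + (S n ω - U n ω)) 0 with h | h
  · rw [max_eq_right h, max_eq_left (by linarith)]; ring
  · rw [max_eq_left h, max_eq_right (by linarith)]; ring

lemma waitingTime_nonneg (n : ℕ) (ω : Ω) : 0 ≤ waitingTime U S n ω := by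
  cases n with
  | zero => simp
  | succ n => rw [waitingTime_succ]; exact le_max_right _ _

lemma idleTime_nonneg (n : ℕ) (ω : Ω) : 0 ≤ idleTime U S n ω := le_max_right _ _

/-- Only customers with index below n enter the waiting time of customer n. Stating this for the
σ-algebra generated by those coordinates makes independence from (U n, S n) a matter of disjoint
index sets. -/
lemma measurable_waitingTime_past (n : ℕ) :
    Measurable[⨆ i ∈ {i : ℕ ⊕ ℕ | i.elim id id < n},
      MeasurableSpace.comap (Sum.elim U S i) inferInstance] (waitingTime U S n) := by
  induction n with
  | zero =>
    have : waitingTime U S 0 = fun _ => 0 := by ext; simp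
    rw [this]; exact measurable_const
  | succ n ih =>
    have hle (i : ℕ ⊕ ℕ) (hi : i.elim id id < n + 1) :
        Measurable[⨆ i ∈ {i : ℕ ⊕ ℕ | i.elim id id < n + 1},
          MeasurableSpace.comap (Sum.elim U S i) inferInstance] (Sum.elim U S i) :=
      (comap_measurable (Sum.elim U S i)).mono
        (le_iSup₂_of_le (f := fun (j : ℕ ⊕ ℕ) (_ : j ∈ {i : ℕ ⊕ ℕ | i.elim id id < n + 1}) =>
          MeasurableSpace.comap (Sum.elim U S j) inferInstance) i hi le_rfl) le_rfl
    have h1 := ih.mono (biSup_mono (f := fun j : ℕ ⊕ ℕ =>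
      MeasurableSpace.comap (Sum.elim U S j) inferInstance)
      (p := fun i => i ∈ {i : ℕ ⊕ ℕ | i.elim id id < n})
      (q := fun i => i ∈ {i : ℕ ⊕ ℕ | i.elim id id < n + 1})
      fun i (hi : _ < _) => Nat.lt_succ_of_lt hi) le_rfl
    have hU := hle (Sum.inl n) (by simp)
    have hS := hle (Sum.inr n) (by simp)
    have : waitingTime U S (n + 1)
        = fun ω => max (waitingTime U S n ω + (S n ω - U n ω)) 0 := by
      ext ω; exact waitingTime_succ n ω
    rw [this]
    exact (h1.add (hS.sub hU)).max measurable_const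

end Chain

/-! ### Independence of a waiting time from the current interarrival and service times -/

namespace IsQueue

variable {Ω : Type*} [MeasurableSpace Ω] {P : Measure Ω} {U S : ℕ → Ω → ℝ}

lemma measurable_elim (h : IsQueue P U S) (i : ℕ ⊕ ℕ) : Measurable (Sum.elim U S i) := by
  cases i with
  | inl n => exact h.measurable_U n
  | inr n => exact h.measurable_S n

lemma measurable_waitingTime (h : IsQueue P U S) (n : ℕ) : Measurable (waitingTime U S n) :=
  (measurable_waitingTime_past n).mono
    (iSup₂_le fun i _ => (h.measurable_elim i).comap_le) le_rfl

lemma measurable_idleTime (h : IsQueue P U S) (n : ℕ) : Measurable (idleTime U S n) :=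
  (((h.measurable_U n).sub (h.measurable_S n)).sub
    (h.measurable_waitingTime n)).max measurable_const

lemma measurable_pair (h : IsQueue P U S) (n : ℕ) : Measurable fun ω => (U n ω, S n ω) :=
  (h.measurable_U n).prodMk (h.measurable_S n)

lemma indepFun_U_S (h : IsQueue P U S) (n : ℕ) : IndepFun (U n) (S n) P :=
  h.indep.indepFun (i := Sum.inl n) (j := Sum.inr n) (by simp)

lemma indepFun_waitingTime (h : IsQueue P U S) (n : ℕ) :
    IndepFun (waitingTime U S n) (fun ω => (U n ω, S n ω)) P := by
  have hd : Disjoint {i : ℕ ⊕ ℕ | i.elim id id < n} {i : ℕ ⊕ ℕ | i.elim id id = n} :=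
    Set.disjoint_left.2 fun i (hi : _ < _) (hj : _ = _) => hi.ne hj
  have hI := indep_iSup_of_disjoint (fun i => (h.measurable_elim i).comap_le) h.indep hd
  rw [IndepFun_iff_Indep]
  refine indep_of_indep_of_le_left (indep_of_indep_of_le_right hI ?_) ?_
  · have hle (i : ℕ ⊕ ℕ) (hi : i.elim id id = n) :
        Measurable[⨆ i ∈ {i : ℕ ⊕ ℕ | i.elim id id = n},
          MeasurableSpace.comap (Sum.elim U S i) inferInstance] (Sum.elim U S i) :=
      (comap_measurable (Sum.elim U S i)).mono
        (le_iSup₂_of_le (f := fun (j : ℕ ⊕ ℕ) (_ : j ∈ {i : ℕ ⊕ ℕ | i.elim id id = n}) =>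
          MeasurableSpace.comap (Sum.elim U S j) inferInstance) i hi le_rfl) le_rfl
    exact Measurable.comap_le ((hle (Sum.inl n) rfl).prodMk (hle (Sum.inr n) rfl))
  · exact (measurable_waitingTime_past n).comap_le

variable [IsProbabilityMeasure P]

lemma identDistrib_pair (h : IsQueue P U S) (n : ℕ) :
    IdentDistrib (fun ω => (U n ω, S n ω)) (fun ω => (U 0 ω, S 0 ω)) P P where
  aemeasurable_fst := (h.measurable_pair n).aemeasurable
  aemeasurable_snd := (h.measurable_pair 0).aemeasurable
  map_eq := by
    rw [(indepFun_iff_map_prod_eq_prod_map_map (h.measurable_U n).aemeasurable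
      (h.measurable_S n).aemeasurable).1 (h.indepFun_U_S n),
      (indepFun_iff_map_prod_eq_prod_map_map (h.measurable_U 0).aemeasurable
      (h.measurable_S 0).aemeasurable).1 (h.indepFun_U_S 0),
      (h.ident_U n).map_eq, (h.ident_S n).map_eq]

/-- Independence factors the expectation, and the pair with index n is replaced by its copy with
index 0, so that moments need to be known only there. -/
lemma integral_waitingTime_mul (h : IsQueue P U S) (n : ℕ) {φ : ℝ → ℝ} {ψ : ℝ × ℝ → ℝ}
    (hφ : Measurable φ) (hψ : Measurable ψ) :
    ∫ ω, φ (waitingTime U S n ω) * ψ (U n ω, S n ω) ∂P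
      = (∫ ω, φ (waitingTime U S n ω) ∂P) * ∫ ω, ψ (U 0 ω, S 0 ω) ∂P := by
  rw [(h.indepFun_waitingTime n).integral_fun_comp_mul_comp
    (h.measurable_waitingTime n).aemeasurable (h.measurable_pair n).aemeasurable
    hφ.aestronglyMeasurable hψ.aestronglyMeasurable]
  congr 1
  exact ((h.identDistrib_pair n).comp hψ).integral_eq

lemma integrable_pair (h : IsQueue P U S) (n : ℕ) {ψ : ℝ × ℝ → ℝ} (hψ : Measurable ψ)
    (hi : Integrable (fun ω => ψ (U 0 ω, S 0 ω)) P) :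
    Integrable (fun ω => ψ (U n ω, S n ω)) P :=
  ((h.identDistrib_pair n).comp hψ).integrable_iff.2 hi

lemma integral_pair (h : IsQueue P U S) (n : ℕ) {ψ : ℝ × ℝ → ℝ} (hψ : Measurable ψ) :
    ∫ ω, ψ (U n ω, S n ω) ∂P = ∫ ω, ψ (U 0 ω, S 0 ω) ∂P :=
  ((h.identDistrib_pair n).comp hψ).integral_eq

lemma integrable_waitingTime_mul (h : IsQueue P U S) (n : ℕ) {φ : ℝ → ℝ} {ψ : ℝ × ℝ → ℝ}
    (hφ : Measurable φ) (hψ : Measurable ψ)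
    (hφi : Integrable (fun ω => φ (waitingTime U S n ω)) P)
    (hψi : Integrable (fun ω => ψ (U 0 ω, S 0 ω)) P) :
    Integrable (fun ω => φ (waitingTime U S n ω) * ψ (U n ω, S n ω)) P :=
  ((h.indepFun_waitingTime n).comp hφ hψ).integrable_mul hφi (h.integrable_pair n hψ hψi)

/-- Integrating out the waiting time. -/
lemma integral_mul_indicator_waitingTime_le (h : IsQueue P U S) (n : ℕ) {F G : ℝ × ℝ → ℝ}
    (hF : Measurable F) (hG : Measurable G) (hFi : Integrable (fun ω => F (U 0 ω, S 0 ω)) P) :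
    ∫ ω, F (U n ω, S n ω) *
        {ω | waitingTime U S n ω ≤ G (U n ω, S n ω)}.indicator 1 ω ∂P
      = ∫ ω, F (U 0 ω, S 0 ω) * P.real {ω' | waitingTime U S n ω' ≤ G (U 0 ω, S 0 ω)} ∂P := by
  have hW := h.measurable_waitingTime n
  have hp := h.measurable_pair n
  have hs : MeasurableSet {p : ℝ × (ℝ × ℝ) | p.1 ≤ G p.2} :=
    measurableSet_le measurable_fst (hG.comp measurable_snd)
  have hmf : Measurable fun p : ℝ × (ℝ × ℝ) =>
      F p.2 * {p : ℝ × (ℝ × ℝ) | p.1 ≤ G p.2}.indicator 1 p :=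
    (hF.comp measurable_snd).mul (measurable_one.indicator hs)
  have hprod := (indepFun_iff_map_prod_eq_prod_map_map hW.aemeasurable hp.aemeasurable).1
    (h.indepFun_waitingTime n)
  have hφ : Measurable fun x : ℝ => P.real {ω' | waitingTime U S n ω' ≤ x} :=
    Monotone.measurable fun x y hxy => measureReal_mono fun ω (hω : _ ≤ _) => hω.trans hxy
  have := Measure.isProbabilityMeasure_map (μ := P) hW.aemeasurable
  have := Measure.isProbabilityMeasure_map (μ := P) hp.aemeasurable
  have e1 : ∫ ω, F (U n ω, S n ω) *
        {ω | waitingTime U S n ω ≤ G (U n ω, S n ω)}.indicator 1 ω ∂P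
      = ∫ p, F p.2 * {p : ℝ × (ℝ × ℝ) | p.1 ≤ G p.2}.indicator 1 p
          ∂(P.map fun ω => (waitingTime U S n ω, (U n ω, S n ω))) := by
    rw [integral_map (hW.prodMk hp).aemeasurable hmf.aestronglyMeasurable]
    rfl
  have hint : Integrable (fun p : ℝ × (ℝ × ℝ) =>
      F p.2 * {p : ℝ × (ℝ × ℝ) | p.1 ≤ G p.2}.indicator 1 p)
      ((P.map (waitingTime U S n)).prod (P.map fun ω => (U n ω, S n ω))) := by
    rw [← hprod, integrable_map_measure hmf.aestronglyMeasurable (hW.prodMk hp).aemeasurable]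
    refine (h.integrable_pair n hF hFi).mono (hmf.comp (hW.prodMk hp)).aestronglyMeasurable
      (Eventually.of_forall fun ω => ?_)
    simp only [Function.comp_apply, norm_mul]
    refine mul_le_of_le_one_right (norm_nonneg _) ?_
    by_cases hx : (waitingTime U S n ω, U n ω, S n ω) ∈ {p : ℝ × (ℝ × ℝ) | p.1 ≤ G p.2} <;>
      simp [Set.indicator, hx]
  -- The waiting time is integrated first, with the pair fixed; this turns the indicator into a
  -- distribution function evaluated at G.
  rw [e1, hprod, integral_prod_symm _ hint]
  rw [← h.integral_pair n (ψ := fun p => F p * P.real {ω' | waitingTime U S n ω' ≤ G p})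
    (hF.mul (hφ.comp hG))]
  refine (integral_map hp.aemeasurable
    hint.swap.integral_prod_left.aestronglyMeasurable).trans ?_
  refine integral_congr_ae (Eventually.of_forall fun ω => ?_)
  simp only [Function.comp_apply, Prod.swap_prod_mk]
  rw [integral_const_mul]
  congr 1
  have : (fun x : ℝ => {p : ℝ × (ℝ × ℝ) | p.1 ≤ G p.2}.indicator (1 : ℝ × (ℝ × ℝ) → ℝ)
      (x, U n ω, S n ω)) = (Set.Iic (G (U n ω, S n ω))).indicator 1 := by
    ext x; simp [Set.indicator]
  rw [this, integral_indicator_one measurableSet_Iic,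
    map_measureReal_apply hW measurableSet_Iic]
  rfl

end IsQueue

/-! ### Lower bound for the survival function from the hazard rate -/

section Survival

variable {Ω : Type*} [MeasurableSpace Ω] {P : Measure Ω} {T : Ω → ℝ} {g : ℝ → ℝ}

lemma hazardRate_le_hazardSup (hb : BddAbove (hazardRate P T g '' Set.Ici 0)) {x : ℝ}
    (hx : 0 ≤ x) : hazardRate P T g x ≤ hazardSup P T g :=
  le_csSup hb ⟨x, hx, rfl⟩

lemma IsDensity.measure_eq_zero (hg : IsDensity P T g) (hT : Measurable T) (x : ℝ) :
    P {ω | T ω = x} = 0 := by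
  have : P.map T {x} = 0 := by
    rw [hg.map_eq]
    exact withDensity_absolutelyContinuous _ _ (by simp)
  rwa [Measure.map_apply hT (measurableSet_singleton x)] at this

variable [IsProbabilityMeasure P]

lemma measureReal_lt_eq_one_sub (hT : Measurable T) (x : ℝ) :
    P.real {ω | x < T ω} = 1 - P.real {ω | T ω ≤ x} := by
  rw [← probReal_compl_eq_one_sub (measurableSet_le hT measurable_const)]
  congr 1; ext; simp

lemma antitone_survival : Antitone fun x => P.real {ω | x < T ω} :=
  fun _ _ hxy => measureReal_mono fun _ hω => lt_of_le_of_lt hxy hω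

/-- The points without mass beyond them form an up-set of the half line. Mass strictly beyond its
infimum is a countable union of null events, and a density leaves no atom at the infimum. At these
points the hazard rate is a division by zero and its bound does not control g, so they must be
discarded. -/
lemma IsDensity.map_survival_eq_zero (hg : IsDensity P T g) (hT : Measurable T) :
    P {ω | 0 ≤ T ω ∧ P.real {ω' | T ω < T ω'} = 0} = 0 := by
  set Z : Set ℝ := {x | 0 ≤ x ∧ P.real {ω | x < T ω} = 0}
  rcases Z.eq_empty_or_nonempty with hZ | hZ
  · have : {ω | 0 ≤ T ω ∧ P.real {ω' | T ω < T ω'} = 0} = ∅ := by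
      ext ω
      simp only [Set.mem_empty_iff_false, iff_false]
      intro h
      exact (hZ ▸ (show T ω ∈ Z from h) : T ω ∈ (∅ : Set ℝ))
    simp [this]
  · have hb : BddBelow Z := ⟨0, fun x hx => hx.1⟩
    have h1 (n : ℕ) : P {ω | sInf Z + 1 / ((n : ℝ) + 1) < T ω} = 0 := by
      obtain ⟨z, hz, hlt⟩ := exists_lt_of_csInf_lt hZ
        (show sInf Z < sInf Z + 1 / ((n : ℝ) + 1) by have : 0 < 1 / ((n : ℝ) + 1) := by positivity
                                                     linarith)
      refine measure_mono_null (fun ω (hω : _ < _) => hlt.trans hω)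
        ((measureReal_eq_zero_iff).1 hz.2)
    refine measure_mono_null (t := {ω | T ω = sInf Z} ∪
      ⋃ n : ℕ, {ω | sInf Z + 1 / ((n : ℝ) + 1) < T ω}) (fun ω hω => ?_)
      (measure_union_null (hg.measure_eq_zero hT _) (measure_iUnion_null h1))
    rcases (csInf_le hb (show T ω ∈ Z from hω)).eq_or_lt with h | h
    · exact Or.inl h.symm
    · right
      obtain ⟨n, hn⟩ := exists_nat_one_div_lt (sub_pos.2 h)
      exact Set.mem_iUnion.2 ⟨n, lt_sub_iff_add_lt'.1 hn⟩

lemma hazardSup_nonneg (hg : IsDensity P T g)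
    (hb : BddAbove (hazardRate P T g '' Set.Ici 0)) : 0 ≤ hazardSup P T g :=
  (div_nonneg (hg.nonneg 0) (sub_nonneg.2 measureReal_le_one)).trans
    (hazardRate_le_hazardSup hb le_rfl)

/-- On (x, x + d] the density is at most sup η · P(T > y) ≤ sup η · P(T > x), since the survival
function decreases; integrate over the interval. -/
lemma IsDensity.survival_add_ge (hg : IsDensity P T g) (hT : Measurable T)
    (hb : BddAbove (hazardRate P T g '' Set.Ici 0)) {x d : ℝ} (hx : 0 ≤ x) (hd : 0 ≤ d) :
    (1 - hazardSup P T g * d) * P.real {ω | x < T ω} ≤ P.real {ω | x + d < T ω} := by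
  have hη := hazardSup_nonneg hg hb
  have hZm : MeasurableSet {y : ℝ | 0 ≤ y ∧ P.real {ω | y < T ω} = 0} :=
    measurableSet_Ici.inter (antitone_survival.measurable (measurableSet_singleton 0))
  have key : P {ω | T ω ∈ Set.Ioc x (x + d)}
      ≤ ENNReal.ofReal (hazardSup P T g * P.real {ω | x < T ω} * d) := by
    have h1 : P {ω | T ω ∈ Set.Ioc x (x + d)} ≤
        P {ω | T ω ∈ Set.Ioc x (x + d) \ {y : ℝ | 0 ≤ y ∧ P.real {ω | y < T ω} = 0}} := by
      rw [← add_zero (P {ω | T ω ∈ Set.Ioc x (x + d) \ _}),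
        ← hg.map_survival_eq_zero hT]
      refine (measure_mono fun ω hω => ?_).trans (measure_union_le _ _)
      by_cases h : 0 ≤ T ω ∧ P.real {ω' | T ω < T ω'} = 0
      · exact Or.inr h
      · exact Or.inl ⟨hω, h⟩
    have h2 := Measure.map_apply hT (μ := P) ((measurableSet_Ioc (a := x) (b := x + d)).diff hZm)
    refine h1.trans ?_
    change P (T ⁻¹' _) ≤ _
    rw [← h2, hg.map_eq, withDensity_apply _ (measurableSet_Ioc.diff hZm)]
    calc ∫⁻ y in Set.Ioc x (x + d) \ {y : ℝ | 0 ≤ y ∧ P.real {ω | y < T ω} = 0},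
          ENNReal.ofReal (g y)
        ≤ ∫⁻ y in Set.Ioc x (x + d) \ {y : ℝ | 0 ≤ y ∧ P.real {ω | y < T ω} = 0},
          ENNReal.ofReal (hazardSup P T g * P.real {ω | x < T ω}) := by
          refine setLIntegral_mono' (measurableSet_Ioc.diff hZm) fun y hy => ?_
          refine ENNReal.ofReal_le_ofReal ?_
          have hy0 : 0 ≤ y := hx.trans hy.1.1.le
          have hpos : 0 < P.real {ω | y < T ω} :=
            measureReal_nonneg.lt_of_ne fun h => hy.2 ⟨hy0, h.symm⟩
          have h3 := hazardRate_le_hazardSup hb hy0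
          rw [hazardRate, ← measureReal_lt_eq_one_sub hT, div_le_iff₀ hpos] at h3
          exact h3.trans (mul_le_mul_of_nonneg_left (antitone_survival hy.1.1.le) hη)
      _ ≤ ENNReal.ofReal (hazardSup P T g * P.real {ω | x < T ω}) * ENNReal.ofReal d := by
          rw [setLIntegral_const]
          gcongr
          refine (measure_mono Set.sdiff_subset).trans ?_
          rw [Real.volume_Ioc]; simp
      _ = _ := (ENNReal.ofReal_mul (mul_nonneg hη measureReal_nonneg)).symm
  have h4 : P.real {ω | T ω ∈ Set.Ioc x (x + d)}
      ≤ hazardSup P T g * P.real {ω | x < T ω} * d :=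
    ENNReal.toReal_le_of_le_ofReal
      (mul_nonneg (mul_nonneg hη measureReal_nonneg) hd) key
  have h5 : P.real {ω | x < T ω}
      ≤ P.real {ω | T ω ∈ Set.Ioc x (x + d)} + P.real {ω | x + d < T ω} := by
    refine (measureReal_mono fun ω hω => ?_).trans (measureReal_union_le _ _)
    rcases le_or_gt (T ω) (x + d) with h | h
    · exact Or.inl ⟨hω, h⟩
    · exact Or.inr h
  linarith

/-- Divide [0, x] into n equal steps, lose at most the factor 1 - sup η · x / n in each, and let n
tend to infinity. -/
lemma IsDensity.exp_neg_le_survival (hg : IsDensity P T g) (hT : Measurable T)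
    (h0 : ∀ᵐ ω ∂P, 0 ≤ T ω) (hb : BddAbove (hazardRate P T g '' Set.Ici 0)) {x : ℝ}
    (hx : 0 ≤ x) : Real.exp (-(hazardSup P T g * x)) ≤ P.real {ω | x < T ω} := by
  have hη := hazardSup_nonneg hg hb
  have hone : P.real {ω | 0 < T ω} = 1 := by
    rw [measureReal_lt_eq_one_sub hT, sub_eq_self, measureReal_eq_zero_iff]
    refine measure_mono_null (t := {ω | T ω = 0} ∪ {ω | ¬ 0 ≤ T ω}) (fun ω hω => ?_)
      (measure_union_null (hg.measure_eq_zero hT 0) h0)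
    by_cases h : 0 ≤ T ω
    · exact Or.inl (le_antisymm (show T ω ≤ 0 from hω) h)
    · exact Or.inr h
  have hlim := Real.tendsto_one_add_div_pow_exp (-(hazardSup P T g * x))
  refine le_of_tendsto hlim ?_
  -- For n ≥ N the factor of one step is nonnegative, so the one-step bounds may be multiplied.
  obtain ⟨N, hN⟩ := exists_nat_ge (hazardSup P T g * x)
  filter_upwards [eventually_ge_atTop (max N 1)] with n hn
  have hn1 : (1 : ℝ) ≤ n := by exact_mod_cast (le_max_right N 1).trans hn
  have hnN : hazardSup P T g * x ≤ n := hN.trans (by exact_mod_cast (le_max_left N 1).trans hn)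
  have hfac : 0 ≤ 1 + -(hazardSup P T g * x) / n := by
    have : hazardSup P T g * x / n ≤ 1 := (div_le_one (by linarith)).2 hnN
    rw [neg_div]; linarith
  have hstep (k : ℕ) : (1 + -(hazardSup P T g * x) / n) ^ k ≤ P.real {ω | k * (x / n) < T ω} := by
    induction k with
    | zero => simp [hone]
    | succ k ih =>
      have := hg.survival_add_ge hT hb (x := k * (x / n)) (d := x / n) (by positivity)
        (by positivity)
      rw [pow_succ']
      calc _ ≤ (1 + -(hazardSup P T g * x) / n) * P.real {ω | k * (x / n) < T ω} :=
            mul_le_mul_of_nonneg_left ih hfac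
        _ = (1 - hazardSup P T g * (x / n)) * P.real {ω | k * (x / n) < T ω} := by ring
        _ ≤ _ := this
        _ = _ := by push_cast; ring_nf
  have := hstep n
  rwa [mul_div_cancel₀ _ (by linarith)] at this

end Survival

/-! ### Growth of the waiting times and mean idle time -/

namespace IsQueue

variable {Ω : Type*} [MeasurableSpace Ω] {P : Measure Ω} {U S : ℕ → Ω → ℝ}

lemma memLp_three {f : Ω → ℝ} (hf : Measurable f) (hi : Integrable (fun ω => f ω ^ 3) P) :
    MemLp f 3 P := by
  rw [← integrable_norm_rpow_iff hf.aestronglyMeasurable (by norm_num) (by norm_num)]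
  have : (3 : ENNReal).toReal = ((3 : ℕ) : ℝ) := by norm_num
  simp_rw [this, Real.rpow_natCast, ← norm_pow]
  exact hi.norm

lemma memLp_U (h : IsQueue P U S) : MemLp (U 0) 3 P := memLp_three (h.measurable_U 0) h.integrable_U

lemma memLp_S (h : IsQueue P U S) : MemLp (S 0) 3 P := memLp_three (h.measurable_S 0) h.integrable_S

lemma memLp_sub (h : IsQueue P U S) : MemLp (fun ω => S 0 ω - U 0 ω) 3 P := h.memLp_S.sub h.memLp_U

variable [IsProbabilityMeasure P]

lemma integrable_sub (h : IsQueue P U S) : Integrable (fun ω => S 0 ω - U 0 ω) P :=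
  h.memLp_sub.integrable (by norm_num)

lemma integrable_sub_sq (h : IsQueue P U S) : Integrable (fun ω => (S 0 ω - U 0 ω) ^ 2) P :=
  (h.memLp_sub.mono_exponent (p := 2) (by norm_num)).integrable_sq

lemma memLp_waitingTime (h : IsQueue P U S) (n : ℕ) : MemLp (waitingTime U S n) 2 P := by
  induction n with
  | zero =>
    have : waitingTime U S 0 = 0 := by ext; simp
    rw [this]; exact MemLp.zero
  | succ n ih =>
    have hξ : MemLp (fun ω => S n ω - U n ω) 2 P :=
      ((h.identDistrib_pair n).comp (u := fun p : ℝ × ℝ => p.2 - p.1)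
        (by fun_prop)).memLp_iff.2 (h.memLp_sub.mono_exponent (by norm_num))
    refine (ih.add hξ).mono (h.measurable_waitingTime _).aestronglyMeasurable
      (Eventually.of_forall fun ω => ?_)
    rw [waitingTime_succ, Real.norm_eq_abs, Real.norm_eq_abs, abs_of_nonneg (le_max_right _ _)]
    exact max_le (le_abs_self _) (abs_nonneg _)

lemma integrable_waitingTime (h : IsQueue P U S) (n : ℕ) : Integrable (waitingTime U S n) P :=
  (h.memLp_waitingTime n).integrable (by norm_num)

/-- Reflection only decreases the square, so W_{n+1}² ≤ (W_n + ξ_n)². The mean of the cross term is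
E W_n · E ξ ≤ 0 by independence, hence each step adds at most E ξ². -/
lemma integral_waitingTime_sq_le (h : IsQueue P U S)
    (hd : ∫ ω, (S 0 ω - U 0 ω) ∂P ≤ 0) (n : ℕ) :
    ∫ ω, waitingTime U S n ω ^ 2 ∂P ≤ n * ∫ ω, (S 0 ω - U 0 ω) ^ 2 ∂P := by
  induction n with
  | zero => simp
  | succ n ih =>
    have hm : Measurable fun p : ℝ × ℝ => p.2 - p.1 := by fun_prop
    have hm2 : Measurable fun p : ℝ × ℝ => (p.2 - p.1) ^ 2 := by fun_prop
    have i1 := (h.memLp_waitingTime n).integrable_sq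
    have i2 := (h.integrable_waitingTime_mul n measurable_id hm (h.integrable_waitingTime n)
      h.integrable_sub)
    have i3 := h.integrable_pair n hm2 h.integrable_sub_sq
    have i12 : Integrable (fun ω => waitingTime U S n ω ^ 2
      + 2 * (waitingTime U S n ω * (S n ω - U n ω))) P := i1.add (i2.const_mul 2)
    have e2 := h.integral_waitingTime_mul n measurable_id hm
    have e3 := h.integral_pair n hm2
    simp only [id] at i2 i3 e2 e3
    have hle : ∫ ω, waitingTime U S (n + 1) ω ^ 2 ∂P
        ≤ ∫ ω, (waitingTime U S n ω ^ 2 + 2 * (waitingTime U S n ω * (S n ω - U n ω))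
          + (S n ω - U n ω) ^ 2) ∂P := by
      refine integral_mono (h.memLp_waitingTime _).integrable_sq
        (i12.add i3) fun ω => ?_
      simp only
      rw [waitingTime_succ]
      rcases le_total (waitingTime U S n ω + (S n ω - U n ω)) 0 with hx | hx
      · rw [max_eq_right hx]
        nlinarith [sq_nonneg (waitingTime U S n ω + (S n ω - U n ω))]
      · rw [max_eq_left hx]; linarith [sq_nonneg (waitingTime U S n ω + (S n ω - U n ω))]
    rw [integral_add i12 i3, integral_add i1 (i2.const_mul 2),
      integral_const_mul, e2, e3] at hle
    have hW : 0 ≤ ∫ ω, waitingTime U S n ω ∂P := integral_nonneg fun ω => waitingTime_nonneg n ω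
    push_cast
    nlinarith [mul_nonneg hW (neg_nonneg.2 hd)]

/-- By (E W_n)² ≤ E W_n² the mean is at most of order √n. This disposes of all boundary terms of the
telescoping sums. -/
lemma tendsto_integral_waitingTime_div (h : IsQueue P U S)
    (hd : ∫ ω, (S 0 ω - U 0 ω) ∂P ≤ 0) :
    Tendsto (fun n : ℕ => (∫ ω, waitingTime U S n ω ∂P) / n) atTop (𝓝 0) := by
  set v := ∫ ω, (S 0 ω - U 0 ω) ^ 2 ∂P
  have hlim : Tendsto (fun n : ℕ => Real.sqrt (v * (1 / (n : ℝ)))) atTop (𝓝 0) := by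
    have := (tendsto_one_div_atTop_nhds_zero_nat (𝕜 := ℝ)).const_mul v
    rw [mul_zero] at this
    have h2 := (Real.continuous_sqrt.tendsto 0).comp this
    rwa [Real.sqrt_zero] at h2
  refine squeeze_zero' (Eventually.of_forall fun n => ?_) ?_ hlim
  · exact div_nonneg (integral_nonneg fun ω => waitingTime_nonneg n ω) n.cast_nonneg
  · filter_upwards [eventually_gt_atTop 0] with n hn
    have hn : (0 : ℝ) < n := by exact_mod_cast hn
    refine Real.le_sqrt_of_sq_le ?_
    have hvar : (∫ ω, waitingTime U S n ω ∂P) ^ 2 ≤ ∫ ω, waitingTime U S n ω ^ 2 ∂P := by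
      have := variance_nonneg (waitingTime U S n) P
      rw [variance_eq_sub (h.memLp_waitingTime n)] at this
      simpa using this
    have := hvar.trans (h.integral_waitingTime_sq_le hd n)
    rw [div_pow, mul_one_div, div_le_div_iff₀ (by positivity) hn]
    nlinarith

lemma integrable_idleTime (h : IsQueue P U S) (n : ℕ) : Integrable (idleTime U S n) P := by
  have : idleTime U S n
      = fun ω => waitingTime U S (n + 1) ω - (waitingTime U S n ω + (S n ω - U n ω)) := by
    ext ω; rw [waitingTime_succ_eq_add_idleTime]; ring
  rw [this]
  exact (h.integrable_waitingTime _).sub ((h.integrable_waitingTime n).add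
    (h.integrable_pair n (ψ := fun p => p.2 - p.1) (by fun_prop) h.integrable_sub))

/-- Telescoping of the recursion. With drift -aδ this makes the total idle time n a δ + o(n), which
is where idle terms gain their factor δ. -/
lemma sum_integral_idleTime (h : IsQueue P U S) (n : ℕ) :
    ∑ k ∈ Finset.range n, ∫ ω, idleTime U S k ω ∂P
      = ∫ ω, waitingTime U S n ω ∂P - n * ∫ ω, (S 0 ω - U 0 ω) ∂P := by
  induction n with
  | zero => simp
  | succ n ih =>
    have hm : Measurable fun p : ℝ × ℝ => p.2 - p.1 := by fun_prop
    have i2 := h.integrable_pair n hm h.integrable_sub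
    have e2 := h.integral_pair n hm
    simp only at i2 e2
    have i12 : Integrable (fun ω => waitingTime U S n ω + (S n ω - U n ω)) P :=
      (h.integrable_waitingTime n).add i2
    rw [Finset.sum_range_succ, ih]
    simp_rw [waitingTime_succ_eq_add_idleTime n]
    rw [integral_add i12 (h.integrable_idleTime n),
      integral_add (h.integrable_waitingTime n) i2, e2]
    push_cast; ring

end IsQueue

/-! ### Squared idle times, by counting short waiting times -/

namespace IsQueue

variable {Ω : Type*} [MeasurableSpace Ω] {P : Measure Ω} {U S : ℕ → Ω → ℝ}

/-- The expected number of customers among the first `n` whose waiting time is at most `x`. -/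
noncomputable def waitingCount (P : Measure Ω) (U S : ℕ → Ω → ℝ) (n : ℕ) (x : ℝ) : ℝ :=
  ∑ k ∈ Finset.range n, P.real {ω | waitingTime U S k ω ≤ x}

lemma waitingCount_nonneg (n : ℕ) (x : ℝ) : 0 ≤ waitingCount P U S n x :=
  Finset.sum_nonneg fun _ _ => measureReal_nonneg

lemma waitingCount_of_neg (n : ℕ) {x : ℝ} (hx : x < 0) : waitingCount P U S n x = 0 := by
  refine Finset.sum_eq_zero fun k _ => ?_
  have : {ω | waitingTime U S k ω ≤ x} = ∅ := by
    ext ω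
    simpa using hx.trans_le (waitingTime_nonneg k ω)
  simp [this]

lemma nonneg_pair (h : IsQueue P U S) (n : ℕ) : ∀ᵐ ω ∂P, 0 ≤ U n ω ∧ 0 ≤ S n ω :=
  (h.nonneg_U n).and (h.nonneg_S n)

variable [IsProbabilityMeasure P]

lemma waitingCount_mono (n : ℕ) : Monotone (waitingCount P U S n) := fun _ _ hxy =>
  Finset.sum_le_sum fun _ _ => measureReal_mono fun _ hω => le_trans hω hxy

lemma waitingCount_le (n : ℕ) (x : ℝ) : waitingCount P U S n x ≤ n := by
  refine (Finset.sum_le_card_nsmul _ _ 1 fun _ _ => measureReal_le_one).trans ?_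
  simp

lemma integrable_waitingCount (h : IsQueue P U S) (n : ℕ) (x : ℝ) :
    Integrable (fun ω => waitingCount P U S n (x - (S 0 ω - U 0 ω))) P := by
  refine Integrable.of_bound (C := n) ((waitingCount_mono n).measurable.comp
    (measurable_const.sub ((h.measurable_S 0).sub (h.measurable_U 0)))).aestronglyMeasurable
    (Eventually.of_forall fun ω => ?_)
  rw [Real.norm_eq_abs, abs_of_nonneg (waitingCount_nonneg _ _)]
  exact waitingCount_le _ _

/-- For x ≥ 0 the maximum with 0 does not matter: W_{k+1} ≤ x exactly when W_k ≤ x - ξ_k, and ξ_k is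
independent of W_k. The summand 1 is customer 0, who does not wait. The result is a renewal-type
recursion. -/
lemma waitingCount_succ (h : IsQueue P U S) (n : ℕ) {x : ℝ} (hx : 0 ≤ x) :
    waitingCount P U S (n + 1) x
      = 1 + ∫ ω, waitingCount P U S n (x - (S 0 ω - U 0 ω)) ∂P := by
  have hm (k : ℕ) : Measurable fun y : ℝ => P.real {ω | waitingTime U S k ω ≤ y} :=
    Monotone.measurable fun _ _ hxy => measureReal_mono fun _ hω => le_trans hω hxy
  have h0 : P.real {ω | waitingTime U S 0 ω ≤ x} = 1 := by simp [hx]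
  rw [waitingCount, Finset.sum_range_succ', h0, add_comm]
  congr 1
  unfold waitingCount
  rw [integral_finsetSum]
  · refine Finset.sum_congr rfl fun k _ => ?_
    have := h.integral_mul_indicator_waitingTime_le k (F := fun _ => 1)
      (G := fun p => x - (p.2 - p.1)) measurable_const (by fun_prop) (integrable_const 1)
    simp only [one_mul] at this
    have hms : MeasurableSet {ω | waitingTime U S k ω ≤ x - (S k ω - U k ω)} :=
      measurableSet_le (h.measurable_waitingTime k)
        (measurable_const.sub ((h.measurable_S k).sub (h.measurable_U k)))
    rw [← this, integral_indicator_one hms]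
    congr 1
    ext ω
    simp only [Set.mem_ofPred_eq, waitingTime_succ, max_le_iff, hx, and_true]
    constructor <;> intro h <;> linarith
  · intro k _
    refine Integrable.of_bound (C := 1) ((hm k).comp
      (measurable_const.sub ((h.measurable_S 0).sub (h.measurable_U 0)))).aestronglyMeasurable
      (Eventually.of_forall fun ω => ?_)
    rw [Real.norm_eq_abs, abs_of_nonneg measureReal_nonneg]
    exact measureReal_le_one

/-- Induction on n through the recursion: increments over unit intervals are averages of earlier
increments, and for x < 0 the bound is monotonicity because the count vanishes there. This gives
linear growth in x, uniformly in the load. -/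
lemma waitingCount_add_one_le (h : IsQueue P U S) (n : ℕ) (x : ℝ) :
    waitingCount P U S n (x + 1) ≤ waitingCount P U S n x + waitingCount P U S n 1 := by
  induction n generalizing x with
  | zero => simp [waitingCount]
  | succ n ih =>
    rcases lt_or_ge x 0 with hx | hx
    · rw [waitingCount_of_neg _ hx, zero_add]
      exact waitingCount_mono _ (by linarith)
    · rw [h.waitingCount_succ n hx, h.waitingCount_succ n (by linarith : 0 ≤ x + 1)]
      have h1 : ∫ ω, waitingCount P U S n (x + 1 - (S 0 ω - U 0 ω)) ∂P
          ≤ ∫ ω, (waitingCount P U S n (x - (S 0 ω - U 0 ω)) + waitingCount P U S n 1) ∂P := by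
        refine integral_mono (h.integrable_waitingCount n _)
          ((h.integrable_waitingCount n _).add (integrable_const _)) fun ω => ?_
        have := ih (x - (S 0 ω - U 0 ω))
        simpa only [sub_add_eq_add_sub] using this
      rw [integral_add (h.integrable_waitingCount n _) (integrable_const _), integral_const,
        probReal_univ, one_smul] at h1
      have h2 : waitingCount P U S n 1 ≤ waitingCount P U S (n + 1) 1 := by
        unfold waitingCount
        rw [Finset.sum_range_succ]
        exact le_add_of_nonneg_right measureReal_nonneg
      linarith

lemma waitingCount_le_mul (h : IsQueue P U S) (n : ℕ) {x : ℝ} (hx : 0 ≤ x) :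
    waitingCount P U S n x ≤ (x + 1) * waitingCount P U S n 1 := by
  have hnat (m : ℕ) : waitingCount P U S n (m + 1) ≤ (m + 1) * waitingCount P U S n 1 := by
    induction m with
    | zero => simp
    | succ m ih =>
      push_cast
      linarith [h.waitingCount_add_one_le n (m + 1)]
  have h1 := hnat ⌊x⌋₊
  have h2 := waitingCount_mono (P := P) (U := U) (S := S) n (Nat.lt_floor_add_one x).le
  have h3 := Nat.floor_le hx
  nlinarith [waitingCount_nonneg (P := P) (U := U) (S := S) n 1]

lemma integrable_U_pow (h : IsQueue P U S) {k : ℕ} (hk : k ≤ 3) :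
    Integrable (fun ω => U 0 ω ^ k) P := by
  have := (h.memLp_U.mono_exponent (p := (k : ENNReal))
    (by exact_mod_cast hk)).integrable_norm_pow'
  refine (integrable_norm_iff ((h.measurable_U 0).pow_const k).aestronglyMeasurable).1 ?_
  simpa using this

lemma integrable_S_pow (h : IsQueue P U S) {k : ℕ} (hk : k ≤ 3) :
    Integrable (fun ω => S 0 ω ^ k) P := by
  have := (h.memLp_S.mono_exponent (p := (k : ENNReal))
    (by exact_mod_cast hk)).integrable_norm_pow'
  refine (integrable_norm_iff ((h.measurable_S 0).pow_const k).aestronglyMeasurable).1 ?_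
  simpa using this

/-- The expected squared idle times in terms of the expected number of short waiting times. -/
lemma sum_integral_idleTime_sq_le_waitingCount (h : IsQueue P U S) (n : ℕ) :
    ∑ k ∈ Finset.range n, ∫ ω, idleTime U S k ω ^ 2 ∂P
      ≤ (∫ ω, U 0 ω ^ 2 ∂P + ∫ ω, U 0 ω ^ 3 ∂P) * waitingCount P U S n 1 := by
  have hm2 : Measurable fun p : ℝ × ℝ => p.1 ^ 2 := by fun_prop
  have hint (k : ℕ) : Integrable (fun ω => U 0 ω ^ 2 *
      P.real {ω' | waitingTime U S k ω' ≤ U 0 ω}) P := by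
    refine (h.integrable_U_pow (by norm_num : 2 ≤ 3)).mul_bdd (c := 1) ?_
      (Eventually.of_forall fun ω => ?_)
    · have hm : Measurable fun y : ℝ => P.real {ω | waitingTime U S k ω ≤ y} :=
        Monotone.measurable fun _ _ hxy => measureReal_mono fun _ hω => le_trans hω hxy
      exact (hm.comp (h.measurable_U 0)).aestronglyMeasurable
    · rw [Real.norm_eq_abs, abs_of_nonneg measureReal_nonneg]
      exact measureReal_le_one
  calc ∑ k ∈ Finset.range n, ∫ ω, idleTime U S k ω ^ 2 ∂P
      ≤ ∑ k ∈ Finset.range n, ∫ ω, U k ω ^ 2 *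
          {ω | waitingTime U S k ω ≤ U k ω}.indicator 1 ω ∂P := by
        refine Finset.sum_le_sum fun k _ => ?_
        refine integral_mono_of_nonneg (Eventually.of_forall fun ω => sq_nonneg _) ?_ ?_
        · refine (h.integrable_pair k hm2 (h.integrable_U_pow (by norm_num : 2 ≤ 3))).mul_bdd
            (c := 1) ?_ (Eventually.of_forall fun ω => ?_)
          · exact (measurable_one.indicator (measurableSet_le (h.measurable_waitingTime k)
              (h.measurable_U k))).aestronglyMeasurable
          · by_cases hx : ω ∈ {ω | waitingTime U S k ω ≤ U k ω} <;> simp [Set.indicator, hx]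
        · filter_upwards [h.nonneg_pair k] with ω hω
          have hW := waitingTime_nonneg (U := U) (S := S) k ω
          -- Idling needs W_k ≤ U_k, and then I_k ≤ U_k.
          rcases le_or_gt (waitingTime U S k ω) (U k ω) with hx | hx
          · rw [Set.indicator_of_mem (show ω ∈ {ω | waitingTime U S k ω ≤ U k ω} from hx), Pi.one_apply, mul_one]
            exact pow_le_pow_left₀ (idleTime_nonneg k ω)
              (max_le (by linarith [hω.2]) hω.1) 2
          · rw [Set.indicator_of_notMem (show ω ∉ {ω | waitingTime U S k ω ≤ U k ω} from not_le.2 hx), mul_zero,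
              idleTime, max_eq_right (by linarith [hω.2])]
            simp
    _ = ∑ k ∈ Finset.range n, ∫ ω, U 0 ω ^ 2 *
          P.real {ω' | waitingTime U S k ω' ≤ U 0 ω} ∂P :=
        Finset.sum_congr rfl fun k _ =>
          h.integral_mul_indicator_waitingTime_le k (F := fun p => p.1 ^ 2) hm2 measurable_fst
            (h.integrable_U_pow (by norm_num : 2 ≤ 3))
    _ = ∫ ω, U 0 ω ^ 2 * waitingCount P U S n (U 0 ω) ∂P := by
        rw [← integral_finsetSum _ fun k _ => hint k]
        simp_rw [waitingCount, Finset.mul_sum]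
    -- Linear growth of the count, with factor U + 1 against U²; this is where the third moment of U
    -- is spent.
    _ ≤ ∫ ω, (U 0 ω ^ 2 + U 0 ω ^ 3) * waitingCount P U S n 1 ∂P := by
        refine integral_mono_ae ?_ (((h.integrable_U_pow (by norm_num : 2 ≤ 3)).add
          h.integrable_U).mul_const _) ?_
        · simp_rw [waitingCount, Finset.mul_sum]
          exact integrable_finsetSum _ fun k _ => hint k
        · filter_upwards [h.nonneg_U 0] with ω hω
          nlinarith [mul_le_mul_of_nonneg_left (h.waitingCount_le_mul n hω) (sq_nonneg (U 0 ω))]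
    _ = _ := by
        rw [integral_mul_const, integral_add (h.integrable_U_pow (by norm_num : 2 ≤ 3))
          h.integrable_U]

/-- Markov's inequality: b / (2b + 1) ≤ 1/2. The summand 1 keeps the level positive when b = 0. -/
lemma half_le_measureReal_S_le (h : IsQueue P U S) :
    1 / 2 ≤ P.real {ω | S 0 ω ≤ 2 * ∫ ω, S 0 ω ∂P + 1} := by
  set b := ∫ ω, S 0 ω ∂P
  have hb : 0 ≤ b := integral_nonneg_of_ae (h.nonneg_S 0)
  have h1 := mul_meas_ge_le_integral_of_nonneg (h.nonneg_S 0)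
    (h.memLp_S.integrable (by norm_num)) (2 * b + 1)
  have h2 : P.real {ω | S 0 ω ≤ 2 * b + 1} = 1 - P.real {ω | 2 * b + 1 < S 0 ω} := by
    rw [measureReal_lt_eq_one_sub (h.measurable_S 0)]; ring
  have h3 : P.real {ω | 2 * b + 1 < S 0 ω} ≤ P.real {ω | 2 * b + 1 ≤ S 0 ω} :=
    measureReal_mono fun ω (hω : 2 * b + 1 < S 0 ω) => (hω.le : 2 * b + 1 ≤ S 0 ω)
  rw [h2]
  change (2 * b + 1) * P.real {ω | 2 * b + 1 ≤ S 0 ω} ≤ b at h1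
  nlinarith

/-- A short waiting time, a short service time and a long interarrival time lead to idling. -/
lemma measureReal_waitingTime_le_one_mul_le (h : IsQueue P U S) (k : ℕ) :
    P.real {ω | waitingTime U S k ω ≤ 1} *
        (1 / 2 * P.real {ω | 2 * ∫ ω, S 0 ω ∂P + 3 < U 0 ω})
      ≤ ∫ ω, idleTime U S k ω ∂P := by
  set b := ∫ ω, S 0 ω ∂P
  have hA : MeasurableSet (Set.Iic (1 : ℝ)) := measurableSet_Iic
  -- Since 2b + 3 = 1 + (2b + 1) + 1, an interarrival time above 2b + 3 exceeds a waiting time of at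
  -- most 1 plus a service time of at most 2b + 1 by more than 1.
  have hB : MeasurableSet (Set.Ioi (2 * b + 3) ×ˢ Set.Iic (2 * b + 1)) :=
    measurableSet_Ioi.prod measurableSet_Iic
  have hm1 : Measurable ((Set.Iic (1 : ℝ)).indicator (1 : ℝ → ℝ)) := measurable_one.indicator hA
  have hm2 : Measurable ((Set.Ioi (2 * b + 3) ×ˢ Set.Iic (2 * b + 1)).indicator
    (1 : ℝ × ℝ → ℝ)) := measurable_one.indicator hB
  have e1 : ∫ ω, (Set.Iic (1 : ℝ)).indicator (1 : ℝ → ℝ) (waitingTime U S k ω) ∂P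
      = P.real {ω | waitingTime U S k ω ≤ 1} :=
    integral_indicator_one (h.measurable_waitingTime k hA)
  have e2 : ∫ ω, (Set.Ioi (2 * b + 3) ×ˢ Set.Iic (2 * b + 1)).indicator
      (1 : ℝ × ℝ → ℝ) (U 0 ω, S 0 ω) ∂P
      = P.real {ω | 2 * b + 3 < U 0 ω} * P.real {ω | S 0 ω ≤ 2 * b + 1} := by
    refine (integral_indicator_one (h.measurable_pair 0 hB)).trans ?_
    have := (h.indepFun_U_S 0).measure_inter_preimage_eq_mul _ _
      (measurableSet_Ioi (a := 2 * b + 3)) (measurableSet_Iic (a := 2 * b + 1))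
    have h' := congrArg ENNReal.toReal this
    rw [ENNReal.toReal_mul] at h'
    exact h'
  have key := h.integral_waitingTime_mul k hm1 hm2
  rw [e1, e2] at key
  calc _ ≤ P.real {ω | waitingTime U S k ω ≤ 1} *
        (P.real {ω | 2 * b + 3 < U 0 ω} * P.real {ω | S 0 ω ≤ 2 * b + 1}) := by
        refine mul_le_mul_of_nonneg_left ?_ measureReal_nonneg
        rw [mul_comm]
        exact mul_le_mul_of_nonneg_left h.half_le_measureReal_S_le measureReal_nonneg
    _ = _ := key.symm
    _ ≤ _ := by
        refine integral_mono_of_nonneg (Eventually.of_forall fun ω => ?_)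
          (h.integrable_idleTime k) (Eventually.of_forall fun ω => ?_)
        · exact mul_nonneg (Set.indicator_nonneg (fun _ _ => zero_le_one) _)
            (Set.indicator_nonneg (fun _ _ => zero_le_one) _)
        · simp only
          by_cases h1 : waitingTime U S k ω ∈ Set.Iic (1 : ℝ)
          · by_cases h2 : (U k ω, S k ω) ∈ Set.Ioi (2 * b + 3) ×ˢ Set.Iic (2 * b + 1)
            · rw [Set.indicator_of_mem h1, Set.indicator_of_mem h2]
              have h3 : 2 * b + 3 < U k ω := h2.1
              have h4 : S k ω ≤ 2 * b + 1 := h2.2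
              have h5 : waitingTime U S k ω ≤ 1 := h1
              simp only [Pi.one_apply, mul_one]
              exact le_max_of_le_left (by linarith)
            · rw [Set.indicator_of_notMem h2, mul_zero]; exact idleTime_nonneg k ω
          · rw [Set.indicator_of_notMem h1, zero_mul]; exact idleTime_nonneg k ω

/-- Both sides are compared with the expected number of waiting times at most 1: it bounds the
squared idle times from above, and the mean idle times bound it in turn. The constant does not
depend on n and stays bounded as ρ approaches 1. -/
lemma sum_integral_idleTime_sq_le (h : IsQueue P U S) {η : ℝ}
    (hη : Real.exp (-(η * (2 * ∫ ω, S 0 ω ∂P + 3)))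
      ≤ P.real {ω | 2 * ∫ ω, S 0 ω ∂P + 3 < U 0 ω}) (n : ℕ) :
    ∑ k ∈ Finset.range n, ∫ ω, idleTime U S k ω ^ 2 ∂P
      ≤ 2 * (∫ ω, U 0 ω ^ 2 ∂P + ∫ ω, U 0 ω ^ 3 ∂P) *
          Real.exp (η * (2 * ∫ ω, S 0 ω ∂P + 3)) *
          ∑ k ∈ Finset.range n, ∫ ω, idleTime U S k ω ∂P := by
  set b := ∫ ω, S 0 ω ∂P
  have hu : 0 ≤ ∫ ω, U 0 ω ^ 2 ∂P + ∫ ω, U 0 ω ^ 3 ∂P :=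
    add_nonneg (integral_nonneg fun ω => sq_nonneg _)
      (integral_nonneg_of_ae ((h.nonneg_U 0).mono fun ω hω => pow_nonneg hω 3))
  have h1 : waitingCount P U S n 1 * (1 / 2 * Real.exp (-(η * (2 * b + 3))))
      ≤ ∑ k ∈ Finset.range n, ∫ ω, idleTime U S k ω ∂P := by
    unfold waitingCount
    rw [Finset.sum_mul]
    refine Finset.sum_le_sum fun k _ => le_trans ?_ (h.measureReal_waitingTime_le_one_mul_le k)
    gcongr
  have h2 : waitingCount P U S n 1 ≤ 2 * Real.exp (η * (2 * b + 3)) *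
      ∑ k ∈ Finset.range n, ∫ ω, idleTime U S k ω ∂P := by
    have := mul_le_mul_of_nonneg_left h1
      (by positivity : 0 ≤ 2 * Real.exp (η * (2 * b + 3)))
    refine le_trans (le_of_eq ?_) this
    rw [Real.exp_neg]
    field_simp
  calc _ ≤ _ := h.sum_integral_idleTime_sq_le_waitingCount n
    _ ≤ _ := mul_le_mul_of_nonneg_left h2 hu
    _ = _ := by ring

end IsQueue

/-! ### Integrals against the exponential law -/

section Exponential

variable {r : ℝ}

lemma expMeasure_eq_withDensity (r : ℝ) :
    expMeasure r = (volume.restrict (Set.Ioi 0)).withDensity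
      fun x => ENNReal.ofReal (r * Real.exp (-(r * x))) := by
  rw [← withDensity_indicator measurableSet_Ioi]
  change volume.withDensity (gammaPDF 1 r) = _
  refine withDensity_congr_ae ?_
  -- The density is positive at 0 and the indicator of the open half line is not; they agree off
  -- this null set.
  have h0 : ∀ᵐ x : ℝ, x ≠ 0 := by simp [ae_iff]
  filter_upwards [h0] with x hx
  change exponentialPDF r x = _
  rw [exponentialPDF_eq]
  rcases lt_or_gt_of_ne hx with h | h
  · simp [Set.indicator, not_le.2 h, not_lt.2 h.le]
  · simp [Set.indicator, h.le, h]

lemma integral_expMeasure (hr : 0 < r) (f : ℝ → ℝ) :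
    ∫ x, f x ∂(expMeasure r) = ∫ x in Set.Ioi 0, r * Real.exp (-(r * x)) * f x := by
  rw [expMeasure_eq_withDensity, integral_withDensity_eq_integral_toReal_smul (by fun_prop)
    (Eventually.of_forall fun _ => ENNReal.ofReal_lt_top)]
  refine integral_congr_ae (Eventually.of_forall fun x => ?_)
  simp only [smul_eq_mul]
  rw [ENNReal.toReal_ofReal (by positivity)]

lemma integrable_expMeasure_iff (hr : 0 < r) (f : ℝ → ℝ) :
    Integrable f (expMeasure r)
      ↔ IntegrableOn (fun x => r * Real.exp (-(r * x)) * f x) (Set.Ioi 0) := by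
  rw [expMeasure_eq_withDensity, integrable_withDensity_iff_integrable_smul' (by fun_prop)
    (Eventually.of_forall fun _ => ENNReal.ofReal_lt_top), IntegrableOn]
  refine integrable_congr (Eventually.of_forall fun x => ?_)
  simp only [smul_eq_mul]
  rw [ENNReal.toReal_ofReal (by positivity)]

lemma integrable_id_expMeasure (hr : 0 < r) : Integrable (fun x => x) (expMeasure r) := by
  rw [integrable_expMeasure_iff hr]
  have h := (integrableOn_rpow_mul_exp_neg_mul_rpow (p := 1) (s := 1) (by norm_num)
    (by norm_num) hr).const_mul r
  refine Integrable.congr h (Eventually.of_forall fun x => ?_)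
  simp only [Real.rpow_one, neg_mul]
  ring

end Exponential

/-! ### The Stein equation of the exponential law -/

section Stein

variable {r B L : ℝ} {h h' : ℝ → ℝ}

/-- The derivative of the solution of the Stein equation for the exponential distribution. -/
noncomputable def steinSol (r : ℝ) (h : ℝ → ℝ) (x : ℝ) : ℝ :=
  ∫ y, h y ∂(expMeasure r) - ∫ y, h (x + y) ∂(expMeasure r)

/-- The second derivative of the solution of the Stein equation. -/
noncomputable def steinSolDeriv (r : ℝ) (h' : ℝ → ℝ) (x : ℝ) : ℝ :=
  -∫ y, h' (x + y) ∂(expMeasure r)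

/-- This boundary value is essential: it removes the first order term when the workload is reflected
at 0 and reduces an idle period to its c γ'(0) part. -/
lemma steinSol_zero : steinSol r h 0 = 0 := by simp [steinSol]

lemma integrable_expMeasure_of_bounded (hr : 0 < r) {f : ℝ → ℝ} (hf : Measurable f)
    (hb : ∀ x, |f x| ≤ B) (x : ℝ) : Integrable (fun y => f (x + y)) (expMeasure r) := by
  have := isProbabilityMeasure_expMeasure hr
  exact Integrable.of_bound (hf.comp (measurable_const_add x)).aestronglyMeasurable B
    (Eventually.of_forall fun y => hb _)

lemma hasDerivAt_steinSol (hr : 0 < r) (hd : ∀ x, HasDerivAt h (h' x) x) (hB : ∀ x, |h x| ≤ B)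
    (h1 : ∀ x, |h' x| ≤ 1) (hm : Measurable h') (x : ℝ) :
    HasDerivAt (steinSol r h) (steinSolDeriv r h' x) x := by
  have := isProbabilityMeasure_expMeasure hr
  have hc : Continuous h := continuous_iff_continuousAt.2 fun x => (hd x).continuousAt
  refine HasDerivAt.const_sub _ ?_
  refine (hasDerivAt_integral_of_dominated_loc_of_deriv_le (F := fun x y => h (x + y))
    (F' := fun x y => h' (x + y)) (bound := fun _ => 1) univ_mem
    (Eventually.of_forall fun z => ?_) ?_ ?_ ?_ (integrable_const 1) ?_).2
  · exact (hc.comp (continuous_const_add z)).aestronglyMeasurable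
  · exact integrable_expMeasure_of_bounded hr hc.measurable hB x
  · exact (hm.comp (measurable_const_add x)).aestronglyMeasurable
  · exact Eventually.of_forall fun y z _ => h1 _
  · exact Eventually.of_forall fun y z _ => HasDerivAt.comp_add_const z y (hd (z + y))

lemma abs_steinSolDeriv_le (hr : 0 < r) (h1 : ∀ x, |h' x| ≤ 1) (x : ℝ) :
    |steinSolDeriv r h' x| ≤ 1 := by
  have := isProbabilityMeasure_expMeasure hr
  rw [steinSolDeriv, abs_neg, ← Real.norm_eq_abs]
  refine (norm_integral_le_of_norm_le_const (C := 1) (Eventually.of_forall fun y => h1 _)).trans ?_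
  simp

lemma abs_steinSol_le (hr : 0 < r) (hB : ∀ x, |h x| ≤ B) (x : ℝ) :
    |steinSol r h x| ≤ 2 * B := by
  have := isProbabilityMeasure_expMeasure hr
  have key (x : ℝ) : |∫ y, h (x + y) ∂(expMeasure r)| ≤ B := by
    rw [← Real.norm_eq_abs]
    refine (norm_integral_le_of_norm_le_const (C := B)
      (Eventually.of_forall fun y => hB _)).trans ?_
    simp
  have h0 := key 0
  simp only [zero_add] at h0
  rw [steinSol]
  exact (abs_sub _ _).trans (by linarith [key x])

lemma abs_steinSolDeriv_sub_le (hr : 0 < r) (h1 : ∀ x, |h' x| ≤ 1) (hm : Measurable h')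
    (h2 : ∀ x y, |h' x - h' y| ≤ L * |x - y|) (x y : ℝ) :
    |steinSolDeriv r h' x - steinSolDeriv r h' y| ≤ L * |x - y| := by
  have := isProbabilityMeasure_expMeasure hr
  have e : steinSolDeriv r h' x - steinSolDeriv r h' y
      = ∫ z, (h' (y + z) - h' (x + z)) ∂(expMeasure r) := by
    rw [integral_sub (integrable_expMeasure_of_bounded hr hm h1 y)
      (integrable_expMeasure_of_bounded hr hm h1 x), steinSolDeriv, steinSolDeriv]
    ring
  rw [e, ← Real.norm_eq_abs]
  refine (norm_integral_le_of_norm_le_const (C := L * |x - y|)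
    (Eventually.of_forall fun z => ?_)).trans (by simp)
  rw [Real.norm_eq_abs]
  have := h2 (y + z) (x + z)
  rwa [add_sub_add_right_eq_sub, abs_sub_comm y x] at this

/-- Integration by parts against r e^{-ry} gives E h'(x + Y) = r (E h(x + Y) - h(x)); substitute
this in the formula for γ'. -/
lemma stein_equation (hr : 0 < r) (hd : ∀ x, HasDerivAt h (h' x) x) (hB : ∀ x, |h x| ≤ B)
    (h1 : ∀ x, |h' x| ≤ 1) (hm : Measurable h') (x : ℝ) :
    1 / r * steinSolDeriv r h' x - steinSol r h x = h x - ∫ y, h y ∂(expMeasure r) := by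
  have hc : Continuous h := continuous_iff_continuousAt.2 fun x => (hd x).continuousAt
  have i1 := (integrable_expMeasure_iff hr _).1
    (integrable_expMeasure_of_bounded hr hc.measurable hB x)
  have i2 := (integrable_expMeasure_iff hr _).1 (integrable_expMeasure_of_bounded hr hm h1 x)
  have hderiv (y : ℝ) : HasDerivAt (fun y => -Real.exp (-(r * y)) * h (x + y))
      (r * Real.exp (-(r * y)) * h (x + y)
        - 1 / r * (r * Real.exp (-(r * y)) * h' (x + y))) y := by
    refine (hasDerivAt_neg_exp_mul_exp.mul (HasDerivAt.comp_const_add x y (hd _))).congr_deriv ?_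
    field_simp
    ring
  have hlim : Tendsto (fun y => -Real.exp (-(r * y)) * h (x + y)) atTop (𝓝 0) := by
    have he : Tendsto (fun y => Real.exp (-(r * y)) * B) atTop (𝓝 0) := by
      have := (Real.tendsto_exp_neg_atTop_nhds_zero.comp
        (tendsto_id.const_mul_atTop hr)).mul_const B
      rwa [zero_mul] at this
    refine squeeze_zero_norm (fun y => ?_) he
    rw [norm_mul, norm_neg, Real.norm_eq_abs, Real.norm_eq_abs, Real.abs_exp]
    exact mul_le_mul_of_nonneg_left (hB _) (Real.exp_pos _).le
  have key := integral_Ioi_of_hasDerivAt_of_tendsto' (a := 0) (fun y _ => hderiv y)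
    (i1.sub (i2.const_mul (1 / r))) hlim
  rw [integral_sub i1 (i2.const_mul (1 / r)), integral_const_mul,
    ← integral_expMeasure hr fun y => h (x + y),
    ← integral_expMeasure hr fun y => h' (x + y)] at key
  simp only [mul_zero, neg_zero, Real.exp_zero, add_zero] at key
  rw [steinSol, steinSolDeriv]
  linarith

end Stein

/-! ### Exchanging expectation and a time integral over a random interval -/

section Region

variable {Ω : Type*} {α β : Ω → ℝ}

/-- The region between the graphs of two functions, with the axes swapped. -/
def regionIco (α β : Ω → ℝ) : Set (Ω × ℝ) := {p | α p.1 ≤ p.2 ∧ p.2 < β p.1}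

lemma indicator_regionIco_apply (F : Ω × ℝ → ℝ) (ω : Ω) (t : ℝ) :
    (regionIco α β).indicator F (ω, t)
      = (Set.Ico (α ω) (β ω)).indicator (fun t => F (ω, t)) t := by
  by_cases h : α ω ≤ t ∧ t < β ω <;> simp [Set.indicator, regionIco, h]

variable [MeasurableSpace Ω] {P : Measure Ω}

lemma measurableSet_regionIco (hα : Measurable α) (hβ : Measurable β) :
    MeasurableSet (regionIco α β) :=
  (measurableSet_le (hα.comp measurable_fst) measurable_snd).inter
    (measurableSet_lt measurable_snd (hβ.comp measurable_fst))

lemma measure_regionIco_lt_top [SFinite P] (hα : Measurable α) (hβ : Measurable β)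
    (hi : Integrable (fun ω => β ω - α ω) P) :
    (P.prod volume) (regionIco α β) < ⊤ := by
  rw [Measure.prod_apply (measurableSet_regionIco hα hβ)]
  have : ∀ ω, volume (Prod.mk ω ⁻¹' regionIco α β) = ENNReal.ofReal (β ω - α ω) := fun ω => by
    rw [← Real.volume_Ico]; rfl
  simp_rw [this]
  exact hi.lintegral_lt_top

lemma integrable_indicator_regionIco [SFinite P] (hα : Measurable α) (hβ : Measurable β)
    (hi : Integrable (fun ω => β ω - α ω) P) {F : Ω × ℝ → ℝ} (hF : Measurable F) {B : ℝ}
    (hB : ∀ p, |F p| ≤ B) :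
    Integrable ((regionIco α β).indicator F) (P.prod volume) := by
  rw [integrable_indicator_iff (measurableSet_regionIco hα hβ)]
  exact IntegrableOn.of_bound (measure_regionIco_lt_top hα hβ hi) hF.aestronglyMeasurable B
    (Eventually.of_forall fun p => hB p)

/-- Fubini on the region between α and β, which has finite measure because β - α is integrable. -/
lemma integral_indicator_regionIco_swap [SFinite P] (hα : Measurable α) (hβ : Measurable β)
    (hi : Integrable (fun ω => β ω - α ω) P) {F : Ω × ℝ → ℝ} (hF : Measurable F) {B : ℝ}
    (hB : ∀ p, |F p| ≤ B) :
    ∫ t, ∫ ω, (regionIco α β).indicator F (ω, t) ∂P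
      = ∫ ω, (∫ t in Set.Ico (α ω) (β ω), F (ω, t)) ∂P := by
  have h := integrable_indicator_regionIco hα hβ hi hF hB
  rw [← integral_integral_swap (f := fun ω t => (regionIco α β).indicator F (ω, t)) h]
  refine integral_congr_ae (Eventually.of_forall fun ω => ?_)
  simp only
  simp_rw [indicator_regionIco_apply]
  rw [integral_indicator measurableSet_Ico]

end Region

/-! ### Arrival times along a path -/

section Paths

variable {Ω : Type*} {U S : ℕ → Ω → ℝ} {ω : Ω}

lemma arrivalTime_succ (n : ℕ) (ω : Ω) :
    arrivalTime U (n + 1) ω = arrivalTime U n ω + U n ω := by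
  simp [arrivalTime, Finset.sum_range_succ]

lemma monotone_arrivalTime (hU : ∀ n, 0 ≤ U n ω) : Monotone fun n => arrivalTime U n ω :=
  monotone_nat_of_le_succ fun n => by rw [arrivalTime_succ]; linarith [hU n]

lemma arrivalTime_nonneg (hU : ∀ n, 0 ≤ U n ω) (n : ℕ) : 0 ≤ arrivalTime U n ω :=
  Finset.sum_nonneg fun i _ => hU i

lemma lastArrival_eq (hU : ∀ n, 0 ≤ U n ω) {k : ℕ} {t : ℝ} (h1 : arrivalTime U k ω ≤ t)
    (h2 : t < arrivalTime U (k + 1) ω) : lastArrival U t ω = k := by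
  have : {n : ℕ | arrivalTime U n ω ≤ t} = Set.Iic k := by
    ext n
    simp only [Set.mem_ofPred_eq, Set.mem_Iic]
    refine ⟨fun hn => ?_, fun hn => (monotone_arrivalTime hU hn).trans h1⟩
    by_contra hlt
    exact absurd (h2.trans_le (monotone_arrivalTime hU (by omega : k + 1 ≤ n))) (not_lt.2 hn)
  rw [lastArrival, this]
  exact csSup_Iic

/-- On `[0, T n)` exactly one interarrival interval contains a given time. -/
lemma sum_indicator_Ico_arrivalTime (hU : ∀ n, 0 ≤ U n ω) (n : ℕ) {t : ℝ} (ht : 0 ≤ t)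
    (F : ℕ → ℝ → ℝ) (G : ℝ → ℝ)
    (hFG : ∀ k t, arrivalTime U k ω ≤ t → t < arrivalTime U (k + 1) ω → F k t = G t) :
    ∑ k ∈ Finset.range n,
        (Set.Ico (arrivalTime U k ω) (arrivalTime U (k + 1) ω)).indicator (F k) t
      = (Set.Iio (arrivalTime U n ω)).indicator G t := by
  induction n with
  | zero => simp [arrivalTime, Set.indicator, ht]
  | succ n ih =>
    rw [Finset.sum_range_succ, ih]
    have hmono := monotone_arrivalTime hU (Nat.le_succ n)
    simp only [Set.indicator, Set.mem_Iio, Set.mem_Ico]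
    rcases lt_or_ge t (arrivalTime U n ω) with h | h
    · simp [h, h.trans_le hmono, not_le.2 h]
    · by_cases h' : t < arrivalTime U (n + 1) ω
      · simp [h, h', not_lt.2 h, hFG n t h h']
      · simp [h', not_lt.2 h]

lemma sum_indicator_Ico_arrivalTime_of_neg (hU : ∀ n, 0 ≤ U n ω) (n : ℕ) {t : ℝ} (ht : t < 0)
    (F : ℕ → ℝ → ℝ) :
    ∑ k ∈ Finset.range n,
      (Set.Ico (arrivalTime U k ω) (arrivalTime U (k + 1) ω)).indicator (F k) t = 0 :=
  Finset.sum_eq_zero fun k _ => Set.indicator_of_notMem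
    (fun h => absurd (h.1.trans_lt ht) (not_lt.2 (arrivalTime_nonneg hU k))) _

end Paths

/-! ### Time averages of the workload -/

namespace IsQueue

variable {Ω : Type*} [MeasurableSpace Ω] {P : Measure Ω} {U S : ℕ → Ω → ℝ}

lemma measurable_arrivalTime (h : IsQueue P U S) (n : ℕ) : Measurable (arrivalTime U n) :=
  Finset.measurable_fun_sum _ fun i _ => h.measurable_U i

lemma measurable_workAfterArrival (h : IsQueue P U S) (n : ℕ) :
    Measurable fun ω => workAfterArrival U S ω n := by
  simp_rw [workAfterArrival_eq]
  exact (h.measurable_waitingTime n).add (h.measurable_S n)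

variable [IsProbabilityMeasure P]

lemma integrable_interarrival (h : IsQueue P U S) (n : ℕ) : Integrable (U n) P :=
  h.integrable_pair n measurable_fst (h.memLp_U.integrable (by norm_num))

lemma integrable_arrivalTime (h : IsQueue P U S) (n : ℕ) : Integrable (arrivalTime U n) P :=
  integrable_finsetSum _ fun i _ => h.integrable_interarrival i

/-- The law of large numbers in L¹. It allows the random horizon T_n to be replaced by n a at a cost
of o(n) in mean. -/
lemma tendsto_integral_abs_arrivalTime_sub (h : IsQueue P U S) :
    Tendsto (fun n : ℕ => (∫ ω, |arrivalTime U n ω - n * ∫ ω, U 0 ω ∂P| ∂P) / n) atTop (𝓝 0) := by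
  have hLp := strong_law_Lp (p := 1) le_rfl (by norm_num) U
    (memLp_one_iff_integrable.2 (h.integrable_interarrival 0))
    (fun i j hij => h.indep.indepFun (i := Sum.inl i) (j := Sum.inl j) (by simpa using hij))
    h.ident_U
  have h1 := (ENNReal.tendsto_toReal (by simp)).comp hLp
  rw [ENNReal.toReal_zero] at h1
  refine h1.congr' ?_
  filter_upwards [eventually_gt_atTop 0] with n hn
  have hn : (0 : ℝ) < n := by exact_mod_cast hn
  rw [Function.comp_apply, eLpNorm_one_eq_lintegral_enorm, ← integral_norm_eq_lintegral_enorm,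
    ← integral_div]
  · refine integral_congr_ae (Eventually.of_forall fun ω => ?_)
    simp only [smul_eq_mul, Real.norm_eq_abs]
    rw [← abs_of_pos hn, ← abs_div, abs_of_pos hn, sub_div, mul_div_cancel_left₀ _ hn.ne',
      div_eq_inv_mul]
    rfl
  · exact (((h.integrable_arrivalTime n).const_mul ((n : ℝ)⁻¹)).sub
      (integrable_const _)).aestronglyMeasurable

/-- The time integral of `f` of the scaled workload over the first `n` interarrival times. -/
lemma abs_sum_integral_workload_le (h : IsQueue P U S) {δ B ε t₀ : ℝ} {f : ℝ → ℝ}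
    (hf : Continuous f) (hB : ∀ x, |f x| ≤ B) (ht₀ : 0 ≤ t₀) (hε : 0 ≤ ε)
    (hX : ∀ t, AEMeasurable (fun ω => δ * workload U S t ω) P)
    (hφ : ∀ t, t₀ ≤ t → |∫ ω, f (δ * workload U S t ω) ∂P| ≤ ε) (n : ℕ) :
    |∑ k ∈ Finset.range n,
        ∫ ω, (∫ r in 0..U k ω, f (δ * max (workAfterArrival U S ω k - r) 0)) ∂P|
      ≤ B * t₀ + ε * (n * ∫ ω, U 0 ω ∂P)
        + B * ∫ ω, |arrivalTime U n ω - n * ∫ ω, U 0 ω ∂P| ∂P := by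
  set a := ∫ ω, U 0 ω ∂P
  have ha : 0 ≤ a := integral_nonneg_of_ae (h.nonneg_U 0)
  have hB0 : 0 ≤ B := (abs_nonneg _).trans (hB 0)
  have hU : ∀ᵐ ω ∂P, ∀ k, 0 ≤ U k ω := ae_all_iff.2 h.nonneg_U
  set F : ℕ → Ω × ℝ → ℝ := fun k p =>
    f (δ * max (workAfterArrival U S p.1 k - (p.2 - arrivalTime U k p.1)) 0) with hF
  have hFm (k : ℕ) : Measurable (F k) := by
    have h1 := h.measurable_workAfterArrival k
    have h2 := h.measurable_arrivalTime k
    refine hf.measurable.comp (measurable_const.mul (Measurable.max ?_ measurable_const))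
    exact (h1.comp measurable_fst).sub (measurable_snd.sub (h2.comp measurable_fst))
  have hi (k : ℕ) : Integrable (fun ω => arrivalTime U (k + 1) ω - arrivalTime U k ω) P :=
    (h.integrable_arrivalTime _).sub (h.integrable_arrivalTime _)
  set R : ℕ → Set (Ω × ℝ) := fun k => regionIco (arrivalTime U k) (arrivalTime U (k + 1)) with hR
  have hInt (k : ℕ) : Integrable ((R k).indicator (F k)) (P.prod volume) :=
    integrable_indicator_regionIco (h.measurable_arrivalTime _) (h.measurable_arrivalTime _)
      (hi k) (hFm k) fun p => hB _
  have step1 (k : ℕ) : ∫ ω, (∫ r in 0..U k ω, f (δ * max (workAfterArrival U S ω k - r) 0)) ∂P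
      = ∫ t, ∫ ω, (R k).indicator (F k) (ω, t) ∂P := by
    rw [integral_indicator_regionIco_swap (h.measurable_arrivalTime _)
      (h.measurable_arrivalTime _) (hi k) (hFm k) fun p => hB _]
    refine integral_congr_ae ?_
    filter_upwards [hU] with ω hω
    rw [integral_Ico_eq_integral_Ioc, ← intervalIntegral.integral_of_le
      (show arrivalTime U k ω ≤ arrivalTime U (k + 1) ω from
        monotone_arrivalTime hω (Nat.le_succ k)), arrivalTime_succ]
    have := intervalIntegral.integral_comp_sub_right (a := arrivalTime U k ω)
      (b := arrivalTime U k ω + U k ω)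
      (fun r => f (δ * max (workAfterArrival U S ω k - r) 0)) (arrivalTime U k ω)
    rw [sub_self, add_sub_cancel_left] at this
    exact this.symm
  have hsum : ∑ k ∈ Finset.range n,
      ∫ ω, (∫ r in 0..U k ω, f (δ * max (workAfterArrival U S ω k - r) 0)) ∂P
      = ∫ t, ∑ k ∈ Finset.range n, ∫ ω, (R k).indicator (F k) (ω, t) ∂P := by
    rw [integral_finsetSum]
    · exact Finset.sum_congr rfl fun k _ => step1 k
    · exact fun k _ => (hInt k).integral_prod_right
  have hsec (k : ℕ) : ∀ᵐ t, Integrable (fun ω => (R k).indicator (F k) (ω, t)) P :=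
    (hInt k).prod_left_ae
  set α : Ω → ℝ := fun ω => min (arrivalTime U n ω) (n * a) with hα
  set β : Ω → ℝ := fun ω => max (arrivalTime U n ω) (n * a) with hβ
  have hαm : Measurable α := (h.measurable_arrivalTime n).min measurable_const
  have hβm : Measurable β := (h.measurable_arrivalTime n).max measurable_const
  have hαβ (ω : Ω) : β ω - α ω = |arrivalTime U n ω - n * a| := max_sub_min_eq_abs' _ _
  have hαβi : Integrable (fun ω => β ω - α ω) P := by
    simp_rw [hαβ]
    exact ((h.integrable_arrivalTime n).sub (integrable_const _)).abs
  have hD : Integrable ((regionIco α β).indicator fun _ => (1 : ℝ)) (P.prod volume) :=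
    integrable_indicator_regionIco hαm hβm hαβi measurable_const (B := 1) (by simp)
  have hDint : ∫ t, ∫ ω, (regionIco α β).indicator (fun _ => (1 : ℝ)) (ω, t) ∂P
      = ∫ ω, |arrivalTime U n ω - n * a| ∂P := by
    rw [integral_indicator_regionIco_swap hαm hβm hαβi measurable_const (B := 1) (by simp)]
    refine integral_congr_ae (Eventually.of_forall fun ω => ?_)
    simp only [integral_const, smul_eq_mul, mul_one, measureReal_restrict_apply_univ]
    rw [Real.volume_real_Ico_of_le (min_le_max), ← hαβ]
  have i1 : Integrable ((Set.Ico 0 t₀).indicator fun _ => B) (volume : Measure ℝ) :=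
    (integrable_indicator_iff measurableSet_Ico).2 (integrableOn_const measure_Ico_lt_top.ne)
  have i2 : Integrable ((Set.Ico 0 (n * a)).indicator fun _ => ε) (volume : Measure ℝ) :=
    (integrable_indicator_iff measurableSet_Ico).2 (integrableOn_const measure_Ico_lt_top.ne)
  have i3 : Integrable (fun t => B * ∫ ω, (regionIco α β).indicator (fun _ => (1 : ℝ)) (ω, t) ∂P)
      (volume : Measure ℝ) := hD.integral_prod_right.const_mul B
  have i12 : Integrable (fun t => (Set.Ico 0 t₀).indicator (fun _ => B) t
      + (Set.Ico 0 (n * a)).indicator (fun _ => ε) t) (volume : Measure ℝ) := i1.add i2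
  have i123 : Integrable (fun t => ((Set.Ico 0 t₀).indicator (fun _ => B) t
      + (Set.Ico 0 (n * a)).indicator (fun _ => ε) t)
      + B * ∫ ω, (regionIco α β).indicator (fun _ => (1 : ℝ)) (ω, t) ∂P)
      (volume : Measure ℝ) := i12.add i3
  -- Three sources of error at time t: times before t₀, where only |f| ≤ B is known; times up to n
  -- a, where the mean of f is at most ε; and the event that t lies between T_n and n a.
  have hbound : ∀ᵐ t, ‖∑ k ∈ Finset.range n, ∫ ω, (R k).indicator (F k) (ω, t) ∂P‖
      ≤ ((Set.Ico 0 t₀).indicator (fun _ => B) t + (Set.Ico 0 (n * a)).indicator (fun _ => ε) t)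
        + B * ∫ ω, (regionIco α β).indicator (fun _ => (1 : ℝ)) (ω, t) ∂P := by
    filter_upwards [ae_all_iff.2 hsec, hD.prod_left_ae] with t ht htD
    rw [← integral_finsetSum _ fun k _ => ht k, Real.norm_eq_abs]
    have hDn : 0 ≤ B * ∫ ω, (regionIco α β).indicator (fun _ => (1 : ℝ)) (ω, t) ∂P :=
      mul_nonneg hB0 (integral_nonneg fun ω => Set.indicator_nonneg (fun _ _ => zero_le_one) _)
    have hn1 : 0 ≤ (Set.Ico 0 t₀).indicator (fun _ => B) t :=
      Set.indicator_nonneg (fun _ _ => hB0) _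
    have hn2 : 0 ≤ (Set.Ico 0 (n * a)).indicator (fun _ => ε) t :=
      Set.indicator_nonneg (fun _ _ => hε) _
    rcases lt_or_ge t 0 with hneg | hpos
    · have : ∫ ω, ∑ k ∈ Finset.range n, (R k).indicator (F k) (ω, t) ∂P = 0 := by
        refine integral_eq_zero_of_ae ?_
        filter_upwards [hU] with ω hω
        simp_rw [hR, indicator_regionIco_apply]
        exact sum_indicator_Ico_arrivalTime_of_neg hω n hneg fun k t => F k (ω, t)
      rw [this, abs_zero]
      linarith
    · have hZ : (fun ω => ∑ k ∈ Finset.range n, (R k).indicator (F k) (ω, t))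
          =ᵐ[P] fun ω => (Set.Iio (arrivalTime U n ω)).indicator
            (fun t => f (δ * workload U S t ω)) t := by
        filter_upwards [hU] with ω hω
        simp_rw [hR, indicator_regionIco_apply]
        refine sum_indicator_Ico_arrivalTime hω n hpos (fun k t => F k (ω, t)) _
          fun k t h1 h2 => ?_
        rw [workload, lastArrival_eq hω h1 h2]
      have hZi : Integrable (fun ω => ∑ k ∈ Finset.range n, (R k).indicator (F k) (ω, t)) P :=
        integrable_finsetSum _ fun k _ => ht k
      have hfX : Integrable (fun ω => f (δ * workload U S t ω)) P :=
        Integrable.of_bound (hf.measurable.comp_aemeasurable (hX t)).aestronglyMeasurable B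
          (Eventually.of_forall fun ω => hB _)
      -- Before n a the sum equals f of the workload unless T_n ≤ t; afterwards it vanishes unless t
      -- < T_n. In both cases the exceptional event is α ≤ t < β.
      rcases lt_or_ge t (n * a) with hlt | hge
      · have hsplit : ∫ ω, ∑ k ∈ Finset.range n, (R k).indicator (F k) (ω, t) ∂P
            = ∫ ω, f (δ * workload U S t ω) ∂P
              - ∫ ω, (f (δ * workload U S t ω)
                - ∑ k ∈ Finset.range n, (R k).indicator (F k) (ω, t)) ∂P := by
          rw [integral_sub hfX hZi]; ring
        have h1 : |∫ ω, f (δ * workload U S t ω) ∂P|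
            ≤ (Set.Ico 0 t₀).indicator (fun _ => B) t
              + (Set.Ico 0 (n * a)).indicator (fun _ => ε) t := by
          rcases lt_or_ge t t₀ with h' | h'
          · rw [Set.indicator_of_mem (show t ∈ Set.Ico 0 t₀ from ⟨hpos, h'⟩)]
            have : |∫ ω, f (δ * workload U S t ω) ∂P| ≤ B := by
              rw [← Real.norm_eq_abs]
              refine (norm_integral_le_of_norm_le_const (C := B)
                (Eventually.of_forall fun ω => hB _)).trans (by simp)
            linarith
          · rw [Set.indicator_of_mem (show t ∈ Set.Ico 0 (n * a) from ⟨hpos, hlt⟩)]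
            linarith [hφ t h']
        have h2 : |∫ ω, (f (δ * workload U S t ω)
                - ∑ k ∈ Finset.range n, (R k).indicator (F k) (ω, t)) ∂P|
            ≤ B * ∫ ω, (regionIco α β).indicator (fun _ => (1 : ℝ)) (ω, t) ∂P := by
          rw [← Real.norm_eq_abs, ← integral_const_mul]
          refine norm_integral_le_of_norm_le (htD.const_mul B) ?_
          filter_upwards [hZ] with ω hω
          rw [hω, indicator_regionIco_apply]
          by_cases hT : t < arrivalTime U n ω
          · rw [Set.indicator_of_mem (show t ∈ Set.Iio _ from hT), sub_self, norm_zero]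
            exact mul_nonneg hB0 (Set.indicator_nonneg (fun _ _ => zero_le_one) _)
          · rw [Set.indicator_of_notMem (show t ∉ Set.Iio _ from hT), sub_zero,
              Set.indicator_of_mem (show t ∈ Set.Ico (α ω) (β ω) from
                ⟨(min_le_left _ _).trans (not_lt.1 hT), hlt.trans_le (le_max_right _ _)⟩), mul_one]
            exact hB _
        rw [hsplit]
        exact (abs_sub _ _).trans (add_le_add h1 h2)
      · have h2 : |∫ ω, ∑ k ∈ Finset.range n, (R k).indicator (F k) (ω, t) ∂P|
            ≤ B * ∫ ω, (regionIco α β).indicator (fun _ => (1 : ℝ)) (ω, t) ∂P := by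
          rw [← Real.norm_eq_abs, ← integral_const_mul]
          refine norm_integral_le_of_norm_le (htD.const_mul B) ?_
          filter_upwards [hZ] with ω hω
          rw [hω, indicator_regionIco_apply]
          by_cases hT : t < arrivalTime U n ω
          · rw [Set.indicator_of_mem (show t ∈ Set.Iio _ from hT),
              Set.indicator_of_mem (show t ∈ Set.Ico (α ω) (β ω) from
                ⟨(min_le_right _ _).trans hge, hT.trans_le (le_max_left _ _)⟩), mul_one]
            exact hB _
          · rw [Set.indicator_of_notMem (show t ∉ Set.Iio _ from hT), norm_zero]
            exact mul_nonneg hB0 (Set.indicator_nonneg (fun _ _ => zero_le_one) _)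
        linarith
  rw [hsum, ← Real.norm_eq_abs]
  refine (norm_integral_le_of_norm_le i123 hbound).trans (le_of_eq ?_)
  rw [integral_add i12 i3, integral_add i1 i2, integral_const_mul, hDint,
    integral_indicator measurableSet_Ico, integral_indicator measurableSet_Ico]
  simp only [integral_const, smul_eq_mul, measureReal_restrict_apply_univ]
  rw [Real.volume_real_Ico_of_le ht₀, Real.volume_real_Ico_of_le (by positivity)]
  ring

/-- The long run time average of `f` is its mean under the limiting distribution. -/
lemma tendsto_average_workload (h : IsQueue P U S) {Ω' : Type*} [MeasurableSpace Ω']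
    {P' : Measure Ω'} [IsProbabilityMeasure P'] {X : Ω' → ℝ}
    (hX : TendstoInDistribution (scaledWorkload U S P) atTop X (fun _ : ℝ => P) P')
    {B : ℝ} {f : ℝ → ℝ} (hf : Continuous f) (hB : ∀ x, |f x| ≤ B) :
    Tendsto (fun n : ℕ => (∑ k ∈ Finset.range n, ∫ ω, (∫ r in 0..U k ω,
        f ((1 - utilization U S P) * max (workAfterArrival U S ω k - r) 0)) ∂P) / n)
      atTop (𝓝 ((∫ ω, U 0 ω ∂P) * ∫ ω, f (X ω) ∂P')) := by
  set a := ∫ ω, U 0 ω ∂P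
  set δ := 1 - utilization U S P
  set m := ∫ ω, f (X ω) ∂P'
  have ha : 0 ≤ a := integral_nonneg_of_ae (h.nonneg_U 0)
  have hB0 : 0 ≤ B := (abs_nonneg _).trans (hB 0)
  have hXm : ∀ t, AEMeasurable (fun ω => δ * workload U S t ω) P := hX.forall_aemeasurable
  have hlim : Tendsto (fun t => ∫ ω, f (δ * workload U S t ω) ∂P) atTop (𝓝 m) := by
    have := ProbabilityMeasure.tendsto_iff_forall_integral_tendsto.1 hX.tendsto
      (BoundedContinuousFunction.ofNormedAddCommGroup f hf B hB)
    simp only [ProbabilityMeasure.coe_mk, BoundedContinuousFunction.coe_ofNormedAddCommGroup]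
      at this
    rw [integral_map hX.aemeasurable_limit hf.aestronglyMeasurable] at this
    refine this.congr fun t => ?_
    exact integral_map (hX.forall_aemeasurable t) hf.aestronglyMeasurable
  have hm : |m| ≤ B := by
    rw [← Real.norm_eq_abs]
    exact (norm_integral_le_of_norm_le_const (C := B)
      (Eventually.of_forall fun ω => hB _)).trans (by simp)
  -- Subtracting the limit m from f makes its mean along the workload eventually smaller than any ε,
  -- as the preceding estimate requires.
  have hcenter (n : ℕ) : ∑ k ∈ Finset.range n, ∫ ω, (∫ r in 0..U k ω,
        (f (δ * max (workAfterArrival U S ω k - r) 0) - m)) ∂P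
      = ∑ k ∈ Finset.range n, ∫ ω, (∫ r in 0..U k ω,
        f (δ * max (workAfterArrival U S ω k - r) 0)) ∂P - n * (a * m) := by
    have hk (k : ℕ) : ∫ ω, (∫ r in 0..U k ω,
        (f (δ * max (workAfterArrival U S ω k - r) 0) - m)) ∂P
        = ∫ ω, (∫ r in 0..U k ω, f (δ * max (workAfterArrival U S ω k - r) 0)) ∂P - a * m := by
      have hc (ω : Ω) : Continuous fun r => f (δ * max (workAfterArrival U S ω k - r) 0) := by
        fun_prop
      have e (ω : Ω) : ∫ r in 0..U k ω, (f (δ * max (workAfterArrival U S ω k - r) 0) - m)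
          = (∫ r in 0..U k ω, f (δ * max (workAfterArrival U S ω k - r) 0)) - U k ω * m := by
        rw [intervalIntegral.integral_sub ((hc ω).intervalIntegrable _ _)
          intervalIntegrable_const]
        simp
      simp_rw [e]
      have hmeas : AEStronglyMeasurable (fun ω =>
          ∫ r in 0..U k ω, f (δ * max (workAfterArrival U S ω k - r) 0)) P := by
        have hF : Measurable fun p : Ω × ℝ =>
            f (δ * max (workAfterArrival U S p.1 k - p.2) 0) := by
          have h1 := h.measurable_workAfterArrival k
          exact hf.measurable.comp (measurable_const.mul
            (((h1.comp measurable_fst).sub measurable_snd).max measurable_const))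
        have h1 := (integrable_indicator_regionIco (P := P) (α := fun _ => 0) (β := U k)
          measurable_const (h.measurable_U k) (by simpa using h.integrable_interarrival k) hF
          fun p => hB _).integral_prod_left.aestronglyMeasurable
        refine h1.congr ?_
        filter_upwards [h.nonneg_U k] with ω hω
        simp_rw [indicator_regionIco_apply]
        rw [integral_indicator measurableSet_Ico, integral_Ico_eq_integral_Ioc,
          intervalIntegral.integral_of_le hω]
      have hint : Integrable (fun ω =>
          ∫ r in 0..U k ω, f (δ * max (workAfterArrival U S ω k - r) 0)) P := by
        refine ((h.integrable_interarrival k).norm.const_mul B).mono' hmeas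
          (Eventually.of_forall fun ω => ?_)
        have := intervalIntegral.norm_integral_le_of_norm_le_const (a := 0) (b := U k ω)
          (f := fun r => f (δ * max (workAfterArrival U S ω k - r) 0)) (C := B) fun r _ => hB _
        rwa [sub_zero] at this
      rw [integral_sub hint ((h.integrable_interarrival k).mul_const m), integral_mul_const,
        (h.ident_U k).integral_eq]
    simp_rw [hk]
    rw [Finset.sum_sub_distrib]
    simp
  have hgoal : Tendsto (fun n : ℕ => (∑ k ∈ Finset.range n, ∫ ω, (∫ r in 0..U k ω,
      (f (δ * max (workAfterArrival U S ω k - r) 0) - m)) ∂P) / n) atTop (𝓝 0) := by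
    rw [Metric.tendsto_atTop]
    intro e he
    -- Chosen so that ε a ≤ e / 2; the summand 1 avoids a separate proof that a is positive.
    set ε := e / (2 * (a + 1))
    have hε : 0 < ε := by positivity
    obtain ⟨t₁, ht₁⟩ := Metric.tendsto_atTop.1 hlim ε hε
    set t₀ := max t₁ 0
    have hφ (t : ℝ) (ht : t₀ ≤ t) : |∫ ω, (f (δ * workload U S t ω) - m) ∂P| ≤ ε := by
      have hfX : Integrable (fun ω => f (δ * workload U S t ω)) P :=
        Integrable.of_bound (hf.measurable.comp_aemeasurable (hXm t)).aestronglyMeasurable B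
          (Eventually.of_forall fun ω => hB _)
      rw [integral_sub hfX (integrable_const _), integral_const, probReal_univ, one_smul]
      exact (ht₁ t ((le_max_left _ _).trans ht)).le
    have hbd := h.abs_sum_integral_workload_le (B := 2 * B) (hf.sub continuous_const)
      (fun x => (abs_sub _ _).trans (by linarith [hB x])) (le_max_right t₁ 0) hε.le hXm hφ
    have hL := ((tendsto_const_div_atTop_nhds_zero_nat (2 * B * t₀)).add
      (h.tendsto_integral_abs_arrivalTime_sub.const_mul (2 * B)))
    rw [mul_zero, add_zero] at hL
    obtain ⟨N, hN⟩ := Metric.tendsto_atTop.1 hL (e / 2) (by positivity)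
    refine ⟨max N 1, fun n hn => ?_⟩
    have hn1 : (1 : ℝ) ≤ n := by exact_mod_cast (le_max_right N 1).trans hn
    have hnpos : (0 : ℝ) < n := by linarith
    have h1 := (le_abs_self _).trans_lt (by
      simpa only [Real.dist_eq, sub_zero] using hN n ((le_max_left N 1).trans hn))
    rw [Real.dist_eq, sub_zero, abs_div, abs_of_pos hnpos]
    have h2 : ε * a ≤ e / 2 := by
      have : ε * (a + 1) = e / 2 := by simp only [ε]; field_simp
      nlinarith
    calc _ ≤ (2 * B * t₀ + ε * (n * a)
          + 2 * B * ∫ ω, |arrivalTime U n ω - n * a| ∂P) / n :=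
          div_le_div_of_nonneg_right (hbd n) hnpos.le
      _ = (2 * B * t₀ / n + 2 * B * ((∫ ω, |arrivalTime U n ω - n * a| ∂P) / n)) + ε * a := by
          field_simp
          ring
      _ < e / 2 + e / 2 := add_lt_add_of_lt_of_le h1 h2
      _ = e := add_halves e
  have := hgoal.add_const (a * m)
  rw [zero_add] at this
  refine this.congr' ?_
  filter_upwards [eventually_gt_atTop 0] with n hn
  have hn : (n : ℝ) ≠ 0 := by exact_mod_cast hn.ne'
  rw [hcenter]
  field_simp
  ring

end IsQueue

/-! ### Taylor estimates for the Stein solution and its primitive -/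

section Taylor

/-- The mean value inequality from 0 to a. Applied to a remainder whose derivative is the remainder
of lower order, it yields the Taylor bounds below, with constants that are not sharp. -/
lemma abs_sub_le_of_abs_deriv_le {F F' : ℝ → ℝ} (hF : ∀ s, HasDerivAt F (F' s) s) {a K : ℝ}
    (hK : ∀ s, |s| ≤ |a| → |F' s| ≤ K) : |F a - F 0| ≤ K * |a| := by
  have h := (convex_uIcc 0 a).norm_image_sub_le_of_norm_hasDerivWithin_le (C := K)
    (f := F) (f' := F') (fun x _ => (hF x).hasDerivWithinAt) (fun x hx => hK x ?_)
    Set.left_mem_uIcc Set.right_mem_uIcc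
  · simpa using h
  · have := Set.abs_sub_left_of_mem_uIcc hx
    simpa using this

variable {γ γ₁ : ℝ → ℝ} {L B δ c : ℝ}

/-- `γ` is bounded by `B`, vanishes at `0` and has the derivative `γ₁`, which is bounded by `1` and
Lipschitz continuous with constant `L`. -/
structure IsTestFunction (γ γ₁ : ℝ → ℝ) (L B : ℝ) : Prop where
  hasDerivAt : ∀ x, HasDerivAt γ (γ₁ x) x
  abs_deriv_le : ∀ x, |γ₁ x| ≤ 1
  abs_deriv_sub_le : ∀ x y, |γ₁ x - γ₁ y| ≤ L * |x - y|
  abs_le : ∀ x, |γ x| ≤ B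
  zero : γ 0 = 0

/-- The antiderivative of `γ (δ x)`. -/
noncomputable def scaledPrimitive (γ : ℝ → ℝ) (δ v : ℝ) : ℝ := ∫ x in 0..v, γ (δ * x)

namespace IsTestFunction

lemma continuous (hγ : IsTestFunction γ γ₁ L B) : Continuous γ :=
  continuous_iff_continuousAt.2 fun x => (hγ.hasDerivAt x).continuousAt

lemma continuous_deriv (hγ : IsTestFunction γ γ₁ L B) : Continuous γ₁ := by
  have h1 := hγ.abs_deriv_sub_le
  refine (LipschitzWith.of_dist_le_mul (K := L.toNNReal) fun x y => ?_).continuous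
  rw [Real.dist_eq, Real.dist_eq]
  exact (h1 x y).trans (mul_le_mul_of_nonneg_right (Real.le_coe_toNNReal L) (abs_nonneg _))

lemma lipschitz_const_nonneg (hγ : IsTestFunction γ γ₁ L B) : 0 ≤ L := by
  have := (abs_nonneg _).trans (hγ.abs_deriv_sub_le 1 0)
  simpa using this

lemma abs_sub_le (hγ : IsTestFunction γ γ₁ L B) (x a : ℝ) : |γ (x + a) - γ x| ≤ |a| := by
  have := abs_sub_le_of_abs_deriv_le (F := fun s => γ (x + s)) (a := a) (K := 1)
    (fun s => HasDerivAt.comp_const_add x s (hγ.hasDerivAt (x + s))) fun s _ => hγ.abs_deriv_le _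
  simpa using this

lemma abs_taylor_le (hγ : IsTestFunction γ γ₁ L B) (x a : ℝ) :
    |γ (x + a) - γ x - a * γ₁ x| ≤ L * a ^ 2 := by
  have := abs_sub_le_of_abs_deriv_le (F := fun s => γ (x + s) - s * γ₁ x) (a := a) (K := L * |a|)
    (fun s => (HasDerivAt.comp_const_add x s (hγ.hasDerivAt (x + s))).sub
      ((hasDerivAt_id s).mul_const (γ₁ x))) fun s hs => by
        have h1 := hγ.abs_deriv_sub_le (x + s) x
        rw [add_sub_cancel_left] at h1
        rw [one_mul]
        exact h1.trans (mul_le_mul_of_nonneg_left hs hγ.lipschitz_const_nonneg)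
  rw [mul_assoc, abs_mul_abs_self, ← sq] at this
  refine le_of_eq_of_le ?_ this
  congr 1
  simp only [add_zero, zero_mul, sub_zero]
  ring

lemma hasDerivAt_scaledPrimitive (hγ : IsTestFunction γ γ₁ L B) (δ v : ℝ) :
    HasDerivAt (scaledPrimitive γ δ) (γ (δ * v)) v :=
  ((hγ.continuous.comp (continuous_const_mul δ)).integral_hasStrictDerivAt 0 v).hasDerivAt

lemma abs_scaledPrimitive_le (hγ : IsTestFunction γ γ₁ L B) (δ v : ℝ) :
    |scaledPrimitive γ δ v| ≤ B * |v| := by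
  have := intervalIntegral.norm_integral_le_of_norm_le_const (a := 0) (b := v)
    (f := fun x => γ (δ * x)) (C := B) fun r _ => hγ.abs_le _
  rwa [sub_zero] at this

lemma abs_scaledPrimitive_sub_le (hγ : IsTestFunction γ γ₁ L B) (hδ : 0 ≤ δ) (v a : ℝ) :
    |scaledPrimitive γ δ (v + a) - scaledPrimitive γ δ v - a * γ (δ * v)| ≤ δ * a ^ 2 := by
  have := abs_sub_le_of_abs_deriv_le
    (F := fun s => scaledPrimitive γ δ (v + s) - s * γ (δ * v)) (a := a) (K := δ * |a|)
    (fun s => (HasDerivAt.comp_const_add v s (hγ.hasDerivAt_scaledPrimitive δ (v + s))).sub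
      ((hasDerivAt_id s).mul_const _)) fun s hs => by
        have h1 := hγ.abs_sub_le (δ * v) (δ * s)
        rw [one_mul, mul_add]
        refine h1.trans ?_
        rw [abs_mul, abs_of_nonneg hδ]
        exact mul_le_mul_of_nonneg_left hs hδ
  rw [mul_assoc, abs_mul_abs_self, ← sq] at this
  refine le_of_eq_of_le ?_ this
  congr 1
  simp only [add_zero, zero_mul, sub_zero]
  ring

/-- Every derivative beyond the first brings a factor δ, so the third order remainder has δ². After
division by the drift aδ an error of order δ remains. -/
lemma abs_scaledPrimitive_taylor_le (hγ : IsTestFunction γ γ₁ L B) (v a : ℝ) :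
    |scaledPrimitive γ δ (v + a) - scaledPrimitive γ δ v - a * γ (δ * v)
        - a ^ 2 / 2 * (δ * γ₁ (δ * v))| ≤ L * δ ^ 2 * |a| ^ 3 := by
  have := abs_sub_le_of_abs_deriv_le
    (F := fun s => scaledPrimitive γ δ (v + s) - s * γ (δ * v) - s ^ 2 / 2 * (δ * γ₁ (δ * v)))
    (F' := fun s => γ (δ * (v + s)) - γ (δ * v) - s * (δ * γ₁ (δ * v)))
    (a := a) (K := L * δ ^ 2 * |a| ^ 2)
    (fun s => (((HasDerivAt.comp_const_add v s
      (hγ.hasDerivAt_scaledPrimitive δ (v + s))).sub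
      ((hasDerivAt_id s).mul_const _)).sub
      (((hasDerivAt_pow 2 s).div_const 2).mul_const _)).congr_deriv (by simp)) fun s hs => by
        have h1 := hγ.abs_taylor_le (δ * v) (δ * s)
        rw [← mul_add] at h1
        have e : γ (δ * (v + s)) - γ (δ * v) - s * (δ * γ₁ (δ * v))
          = γ (δ * (v + s)) - γ (δ * v) - δ * s * γ₁ (δ * v) := by ring
        rw [e]
        refine h1.trans ?_
        rw [mul_pow, ← mul_assoc, ← sq_abs s]
        have := hγ.lipschitz_const_nonneg
        gcongr
  refine le_of_eq_of_le ?_ (this.trans (le_of_eq (by ring)))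
  congr 1
  simp only [add_zero, zero_mul, sub_zero, ne_eq, OfNat.ofNat_ne_zero, not_false_eq_true,
    zero_pow, zero_div]
  ring

/-- The time integral of `f = c γ' - γ` along the path of a workload that decreases from `q`. -/
lemma integral_depletion (hγ : IsTestFunction γ γ₁ L B) (hδ : 0 < δ) {q : ℝ} (hq : 0 ≤ q)
    (u : ℝ) :
    ∫ r in 0..u, (c * γ₁ (δ * max (q - r) 0) - γ (δ * max (q - r) 0))
      = (c / δ * γ (δ * q) - scaledPrimitive γ δ q)
        - (c / δ * γ (δ * max (q - u) 0) - scaledPrimitive γ δ (max (q - u) 0))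
        + max (u - q) 0 * (c * γ₁ 0) := by
  have hc := hγ.continuous
  have hc1 := hγ.continuous_deriv
  have hcont : Continuous fun x => c * γ₁ (δ * max x 0) - γ (δ * max x 0) := by fun_prop
  have hΦ (x : ℝ) : HasDerivAt (fun x => c / δ * γ (δ * x) - scaledPrimitive γ δ x)
      (c * γ₁ (δ * x) - γ (δ * x)) x := by
    refine ((((hγ.hasDerivAt (δ * x)).comp x ((hasDerivAt_id x).const_mul δ)).const_mul
      (c / δ)).sub (hγ.hasDerivAt_scaledPrimitive δ x)).congr_deriv ?_
    simp only [mul_one]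
    field_simp
  -- After x = q - r the range [q - u, q] is cut at max(q - u, 0). Above the cut the integrand has
  -- the antiderivative of `hΦ`; below it the server idles and the integrand is the constant c
  -- γ₁(0), because γ(0) = 0.
  rw [intervalIntegral.integral_comp_sub_left
    (fun x => c * γ₁ (δ * max x 0) - γ (δ * max x 0)) q, sub_zero,
    ← intervalIntegral.integral_add_adjacent_intervals (b := max (q - u) 0)
      (hcont.intervalIntegrable _ _) (hcont.intervalIntegrable _ _), add_comm]
  congr 1
  · have hsub : ∀ x ∈ Set.uIcc (max (q - u) 0) q, 0 ≤ x := fun x hx =>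
      (le_min (le_max_right _ _) hq).trans hx.1
    rw [intervalIntegral.integral_congr (g := fun x => c * γ₁ (δ * x) - γ (δ * x))
      fun x hx => by simp only [max_eq_left (hsub x hx)]]
    exact intervalIntegral.integral_eq_sub_of_hasDerivAt (fun x _ => hΦ x)
      (Continuous.intervalIntegrable (by fun_prop) _ _)
  · rcases le_total (q - u) 0 with h | h
    · rw [max_eq_right h, max_eq_left (by linarith),
        intervalIntegral.integral_congr (g := fun _ => c * γ₁ 0) fun x hx => ?_]
      · simp
        ring
      · rw [Set.uIcc_of_le h] at hx
        simp [max_eq_right hx.2, hγ.zero]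
    · rw [max_eq_left h, max_eq_right (by linarith)]
      simp

end IsTestFunction

end Taylor

/-! ### Summing the recursion and the time integrals -/

namespace IsQueue

section Step

variable {Ω : Type*} {U S : ℕ → Ω → ℝ} {γ γ₁ : ℝ → ℝ} {L B δ : ℝ}

/-- One step of the workload recursion, in terms of the primitive of the test function. -/
lemma abs_scaledPrimitive_step_le (hγ : IsTestFunction γ γ₁ L B) (hδ : 0 ≤ δ) (k : ℕ) (ω : Ω) :
    |scaledPrimitive γ δ (waitingTime U S (k + 1) ω) - scaledPrimitive γ δ (waitingTime U S k ω)
        - (S k ω - U k ω) * γ (δ * waitingTime U S k ω)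
        - (S k ω - U k ω) ^ 2 / 2 * (δ * γ₁ (δ * waitingTime U S k ω))|
      ≤ L * δ ^ 2 * |S k ω - U k ω| ^ 3 + δ * idleTime U S k ω ^ 2 := by
  have h1 := hγ.abs_scaledPrimitive_taylor_le (δ := δ) (waitingTime U S k ω) (S k ω - U k ω)
  -- Reflection moves the argument from -I to 0. Since γ vanishes at 0, the primitive is flat there
  -- to first order, and the cost is only δ I².
  have h2 : |scaledPrimitive γ δ (waitingTime U S (k + 1) ω)
      - scaledPrimitive γ δ (waitingTime U S k ω + (S k ω - U k ω))|
      ≤ δ * idleTime U S k ω ^ 2 := by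
    rw [waitingTime_succ, idleTime]
    rcases le_total (waitingTime U S k ω + (S k ω - U k ω)) 0 with hx | hx
    · rw [max_eq_right hx, max_eq_left (by linarith)]
      have := hγ.abs_scaledPrimitive_sub_le hδ 0 (waitingTime U S k ω + (S k ω - U k ω))
      rw [mul_zero, hγ.zero, mul_zero, sub_zero, zero_add, abs_sub_comm] at this
      refine this.trans (le_of_eq ?_)
      ring
    · rw [max_eq_left hx, sub_self, abs_zero]
      positivity
  have := abs_add_le (scaledPrimitive γ δ (waitingTime U S (k + 1) ω)
      - scaledPrimitive γ δ (waitingTime U S k ω + (S k ω - U k ω))) _ |>.trans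
        (add_le_add h2 h1)
  rw [add_comm (δ * _)] at this
  refine le_of_eq_of_le ?_ this
  congr 1
  ring

end Step

variable {Ω : Type*} [MeasurableSpace Ω] {P : Measure Ω} [IsProbabilityMeasure P]
  {U S : ℕ → Ω → ℝ} {γ γ₁ : ℝ → ℝ} {L B δ c : ℝ}

lemma integrable_idleTime_sq (h : IsQueue P U S) (k : ℕ) :
    Integrable (fun ω => idleTime U S k ω ^ 2) P := by
  refine (h.integrable_pair k (ψ := fun p => p.1 ^ 2) (by fun_prop)
    (h.integrable_U_pow (by norm_num : 2 ≤ 3))).mono'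
    ((h.measurable_idleTime k).pow_const 2).aestronglyMeasurable ?_
  filter_upwards [h.nonneg_pair k] with ω hω
  rw [Real.norm_eq_abs, abs_of_nonneg (sq_nonneg _)]
  refine pow_le_pow_left₀ (idleTime_nonneg k ω) (max_le ?_ hω.1) 2
  linarith [hω.2, waitingTime_nonneg (U := U) (S := S) k ω]

lemma integrable_abs_sub_pow_three (h : IsQueue P U S) :
    Integrable (fun ω => |S 0 ω - U 0 ω| ^ 3) P := by
  have := MemLp.integrable_norm_pow' (p := 3) (by exact_mod_cast h.memLp_sub)
  exact this

lemma integrable_comp_waitingTime (h : IsQueue P U S) {φ : ℝ → ℝ} (hφ : Measurable φ) {D E : ℝ}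
    (hb : ∀ x, |φ x| ≤ D + E * |x|) (k : ℕ) : Integrable (fun ω => φ (waitingTime U S k ω)) P :=
  ((integrable_const D).add ((h.integrable_waitingTime k).abs.const_mul E)).mono'
    (hφ.comp (h.measurable_waitingTime k)).aestronglyMeasurable
    (Eventually.of_forall fun _ => hb _)

/-- Summation of the workload recursion. -/
lemma abs_integral_scaledPrimitive_sub_le (h : IsQueue P U S) (hγ : IsTestFunction γ γ₁ L B)
    (hδ : 0 ≤ δ) (hdrift : ∫ ω, (S 0 ω - U 0 ω) ∂P = -((∫ ω, U 0 ω ∂P) * δ))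
    (hc : ∫ ω, (S 0 ω - U 0 ω) ^ 2 ∂P = 2 * ((∫ ω, U 0 ω ∂P) * c)) (n : ℕ) :
    |∫ ω, scaledPrimitive γ δ (waitingTime U S n ω) ∂P
        - (∫ ω, U 0 ω ∂P) * δ * ∑ k ∈ Finset.range n,
          ∫ ω, (c * γ₁ (δ * waitingTime U S k ω) - γ (δ * waitingTime U S k ω)) ∂P|
      ≤ n * (L * δ ^ 2 * ∫ ω, |S 0 ω - U 0 ω| ^ 3 ∂P)
        + δ * ∑ k ∈ Finset.range n, ∫ ω, idleTime U S k ω ^ 2 ∂P := by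
  set a := ∫ ω, U 0 ω ∂P
  have hcγ := hγ.continuous
  have hcγ₁ := hγ.continuous_deriv
  have hΓ : Continuous (scaledPrimitive γ δ) :=
    continuous_iff_continuousAt.2 fun x => (hγ.hasDerivAt_scaledPrimitive δ x).continuousAt
  have hm1 : Measurable fun p : ℝ × ℝ => p.2 - p.1 := by fun_prop
  have hm2 : Measurable fun p : ℝ × ℝ => (p.2 - p.1) ^ 2 / 2 := by fun_prop
  have hm3 : Measurable fun p : ℝ × ℝ => |p.2 - p.1| ^ 3 := by fun_prop
  have hφ1 : Measurable fun x => γ (δ * x) := by fun_prop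
  have hφ2 : Measurable fun x => δ * γ₁ (δ * x) := by fun_prop
  have hiΓ (k : ℕ) : Integrable (fun ω => scaledPrimitive γ δ (waitingTime U S k ω)) P :=
    h.integrable_comp_waitingTime hΓ.measurable (D := 0) (E := B)
      (fun x => by simpa using hγ.abs_scaledPrimitive_le δ x) k
  have hiγ (k : ℕ) : Integrable (fun ω => γ (δ * waitingTime U S k ω)) P :=
    h.integrable_comp_waitingTime hφ1 (D := B) (E := 0) (fun x => by simpa using hγ.abs_le _) k
  have hiγ₁ (k : ℕ) : Integrable (fun ω => γ₁ (δ * waitingTime U S k ω)) P :=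
    h.integrable_comp_waitingTime (φ := fun x => γ₁ (δ * x)) (by fun_prop) (D := 1) (E := 0)
      (fun x => by simpa using hγ.abs_deriv_le _) k
  have hstep (k : ℕ) : |∫ ω, scaledPrimitive γ δ (waitingTime U S (k + 1) ω) ∂P
      - ∫ ω, scaledPrimitive γ δ (waitingTime U S k ω) ∂P
      - a * δ * ∫ ω, (c * γ₁ (δ * waitingTime U S k ω) - γ (δ * waitingTime U S k ω)) ∂P|
      ≤ L * δ ^ 2 * ∫ ω, |S 0 ω - U 0 ω| ^ 3 ∂P + δ * ∫ ω, idleTime U S k ω ^ 2 ∂P := by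
    have j1 : Integrable (fun ω => (S k ω - U k ω) * γ (δ * waitingTime U S k ω)) P := by
      simpa only [mul_comm] using h.integrable_waitingTime_mul k hφ1 hm1 (hiγ k) h.integrable_sub
    have j2 : Integrable (fun ω => (S k ω - U k ω) ^ 2 / 2 *
        (δ * γ₁ (δ * waitingTime U S k ω))) P := by
      simpa only [mul_comm] using h.integrable_waitingTime_mul k hφ2 hm2 ((hiγ₁ k).const_mul δ)
        (h.integrable_sub_sq.div_const 2)
    -- The first order term contributes -aδ E γ and the second order term aδ c E γ₁. Their sum is aδ
    -- times the mean of the Stein expression c γ₁ - γ; the hypothesis on c is made for this.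
    have e1 : ∫ ω, (S k ω - U k ω) * γ (δ * waitingTime U S k ω) ∂P
        = -(a * δ) * ∫ ω, γ (δ * waitingTime U S k ω) ∂P := by
      have := h.integral_waitingTime_mul k hφ1 hm1
      simp only at this
      rw [hdrift] at this
      rw [mul_comm, ← this]
      simp only [mul_comm]
    have e2 : ∫ ω, (S k ω - U k ω) ^ 2 / 2 * (δ * γ₁ (δ * waitingTime U S k ω)) ∂P
        = a * δ * (c * ∫ ω, γ₁ (δ * waitingTime U S k ω) ∂P) := by
      have := h.integral_waitingTime_mul k hφ2 hm2
      simp only at this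
      rw [integral_div, hc, integral_const_mul] at this
      have e : a * δ * (c * ∫ ω, γ₁ (δ * waitingTime U S k ω) ∂P)
        = (δ * ∫ ω, γ₁ (δ * waitingTime U S k ω) ∂P) * (2 * (a * c) / 2) := by ring
      rw [e, ← this]
      simp only [mul_comm]
    have e3 : ∫ ω, |S k ω - U k ω| ^ 3 ∂P = ∫ ω, |S 0 ω - U 0 ω| ^ 3 ∂P := h.integral_pair k hm3
    have i3 : Integrable (fun ω => |S k ω - U k ω| ^ 3) P :=
      h.integrable_pair k hm3 h.integrable_abs_sub_pow_three
    have d1 : Integrable (fun ω => scaledPrimitive γ δ (waitingTime U S (k + 1) ω)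
      - scaledPrimitive γ δ (waitingTime U S k ω)) P := (hiΓ _).sub (hiΓ _)
    have d2 : Integrable (fun ω => scaledPrimitive γ δ (waitingTime U S (k + 1) ω)
      - scaledPrimitive γ δ (waitingTime U S k ω)
      - (S k ω - U k ω) * γ (δ * waitingTime U S k ω)) P := d1.sub j1
    have i34 : Integrable (fun ω => L * δ ^ 2 * |S k ω - U k ω| ^ 3
        + δ * idleTime U S k ω ^ 2) P :=
      (i3.const_mul (L * δ ^ 2)).add ((h.integrable_idleTime_sq k).const_mul δ)
    have key := norm_integral_le_of_norm_le (f := fun ω =>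
        scaledPrimitive γ δ (waitingTime U S (k + 1) ω) - scaledPrimitive γ δ (waitingTime U S k ω)
          - (S k ω - U k ω) * γ (δ * waitingTime U S k ω)
          - (S k ω - U k ω) ^ 2 / 2 * (δ * γ₁ (δ * waitingTime U S k ω))) i34
      (Eventually.of_forall fun ω => abs_scaledPrimitive_step_le (U := U) (S := S) hγ hδ k ω)
    rw [integral_sub d2 j2, integral_sub d1 j1, integral_sub (hiΓ _) (hiΓ _), e1, e2,
      integral_add (i3.const_mul (L * δ ^ 2)) ((h.integrable_idleTime_sq k).const_mul δ),
      integral_const_mul, integral_const_mul, e3, Real.norm_eq_abs] at key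
    rw [integral_sub ((hiγ₁ k).const_mul c) (hiγ k), integral_const_mul]
    refine le_of_eq_of_le ?_ key
    congr 1
    ring
  induction n with
  | zero => simp [scaledPrimitive]
  | succ n ih =>
    rw [Finset.sum_range_succ, Finset.sum_range_succ]
    have := (abs_add_le _ _).trans (add_le_add ih (hstep n))
    push_cast
    refine le_of_eq_of_le ?_ (this.trans (le_of_eq (by ring)))
    congr 1
    ring

/-- Summation of the time integrals of `f = c γ' - γ` over the interarrival intervals. -/
lemma abs_sum_integral_depletion_le (h : IsQueue P U S) (hγ : IsTestFunction γ γ₁ L B)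
    (hδ : 0 < δ) (hc0 : 0 ≤ c) (n : ℕ) :
    |∑ k ∈ Finset.range n, ∫ ω, (∫ r in 0..U k ω,
          (c * γ₁ (δ * max (workAfterArrival U S ω k - r) 0)
            - γ (δ * max (workAfterArrival U S ω k - r) 0))) ∂P
        + ∫ ω, (c / δ * γ (δ * waitingTime U S n ω)
            - scaledPrimitive γ δ (waitingTime U S n ω)) ∂P
        - c * γ₁ 0 * ∑ k ∈ Finset.range n, ∫ ω, idleTime U S k ω ∂P
        - (∫ ω, S 0 ω ∂P) * ∑ k ∈ Finset.range n,
          ∫ ω, (c * γ₁ (δ * waitingTime U S k ω) - γ (δ * waitingTime U S k ω)) ∂P|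
      ≤ n * (δ * (c * L + 1) * ∫ ω, S 0 ω ^ 2 ∂P) := by
  set b := ∫ ω, S 0 ω ∂P
  have hcγ := hγ.continuous
  have hcγ₁ := hγ.continuous_deriv
  have hΓ : Continuous (scaledPrimitive γ δ) :=
    continuous_iff_continuousAt.2 fun x => (hγ.hasDerivAt_scaledPrimitive δ x).continuousAt
  set Φ : ℝ → ℝ := fun v => c / δ * γ (δ * v) - scaledPrimitive γ δ v with hΦ
  have hΦc : Continuous Φ := by fun_prop
  have hΦb (v : ℝ) : |Φ v| ≤ c / δ * B + B * |v| := by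
    refine (abs_sub _ _).trans (add_le_add ?_ (hγ.abs_scaledPrimitive_le δ v))
    rw [abs_mul, abs_of_nonneg (by positivity : 0 ≤ c / δ)]
    exact mul_le_mul_of_nonneg_left (hγ.abs_le _) (by positivity)
  have hφ : Measurable fun x => c * γ₁ (δ * x) - γ (δ * x) := by fun_prop
  have hiΦ (k : ℕ) : Integrable (fun ω => Φ (waitingTime U S k ω)) P :=
    h.integrable_comp_waitingTime hΦc.measurable hΦb k
  have hiφ (k : ℕ) : Integrable (fun ω => c * γ₁ (δ * waitingTime U S k ω)
      - γ (δ * waitingTime U S k ω)) P :=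
    h.integrable_comp_waitingTime hφ (D := c + B) (E := 0) (fun x => by
      rw [zero_mul, add_zero]
      refine (abs_sub _ _).trans (add_le_add ?_ (hγ.abs_le _))
      rw [abs_mul, abs_of_nonneg hc0]
      exact mul_le_of_le_one_right hc0 (hγ.abs_deriv_le _)) k
  have hm2 : Measurable fun p : ℝ × ℝ => p.2 ^ 2 := by fun_prop
  have hiS (k : ℕ) : Integrable (S k) P :=
    h.integrable_pair k measurable_snd (h.memLp_S.integrable (by norm_num))
  have hiΦ' (k : ℕ) : Integrable (fun ω => Φ (waitingTime U S k ω + S k ω)) P := by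
    refine ((integrable_const (c / δ * B)).add
      (((h.integrable_waitingTime k).add (hiS k)).abs.const_mul B)).mono'
      (hΦc.measurable.comp ((h.measurable_waitingTime k).add
        (h.measurable_S k))).aestronglyMeasurable (Eventually.of_forall fun ω => hΦb _)
  have hpath (k : ℕ) : ∫ ω, (∫ r in 0..U k ω,
          (c * γ₁ (δ * max (workAfterArrival U S ω k - r) 0)
            - γ (δ * max (workAfterArrival U S ω k - r) 0))) ∂P
      = ∫ ω, Φ (waitingTime U S k ω + S k ω) ∂P - ∫ ω, Φ (waitingTime U S (k + 1) ω) ∂P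
        + c * γ₁ 0 * ∫ ω, idleTime U S k ω ∂P := by
    have hd : Integrable (fun ω => Φ (waitingTime U S k ω + S k ω)
      - Φ (waitingTime U S (k + 1) ω)) P := (hiΦ' k).sub (hiΦ (k + 1))
    rw [← integral_sub (hiΦ' k) (hiΦ (k + 1)), ← integral_const_mul,
      ← integral_add hd ((h.integrable_idleTime k).const_mul _)]
    refine integral_congr_ae ?_
    filter_upwards [h.nonneg_S k] with ω hω
    have hW := waitingTime_nonneg (U := U) (S := S) k ω
    rw [hγ.integral_depletion hδ (by rw [workAfterArrival_eq]; exact add_nonneg hW hω)]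
    rw [workAfterArrival_eq, waitingTime_succ, idleTime, ← add_sub_assoc, mul_comm (c * γ₁ 0)]
    have : U k ω - (waitingTime U S k ω + S k ω) = U k ω - S k ω - waitingTime U S k ω := by ring
    rw [this]
  -- The derivative of Φ at w is c γ₁(δ w) - γ(δ w), so the arrival of work S raises Φ by S times
  -- this. The errors (c/δ) L (δ S)² and δ S² are both of order δ.
  have hstep (k : ℕ) : |∫ ω, Φ (waitingTime U S k ω + S k ω) ∂P - ∫ ω, Φ (waitingTime U S k ω) ∂P
      - b * ∫ ω, (c * γ₁ (δ * waitingTime U S k ω) - γ (δ * waitingTime U S k ω)) ∂P|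
      ≤ δ * (c * L + 1) * ∫ ω, S 0 ω ^ 2 ∂P := by
    have i2 : Integrable (fun ω => S k ω ^ 2) P :=
      h.integrable_pair k hm2 (h.integrable_S_pow (by norm_num : 2 ≤ 3))
    have e2 : ∫ ω, S k ω ^ 2 ∂P = ∫ ω, S 0 ω ^ 2 ∂P := h.integral_pair k hm2
    have j1 := h.integrable_waitingTime_mul k hφ measurable_snd (hiφ k)
      (h.memLp_S.integrable (by norm_num))
    have e1 := h.integral_waitingTime_mul k hφ measurable_snd
    simp only at j1 e1
    have d1 : Integrable (fun ω => Φ (waitingTime U S k ω + S k ω)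
      - Φ (waitingTime U S k ω)) P := (hiΦ' k).sub (hiΦ k)
    have key := norm_integral_le_of_norm_le (f := fun ω => Φ (waitingTime U S k ω + S k ω)
      - Φ (waitingTime U S k ω) - (c * γ₁ (δ * waitingTime U S k ω)
        - γ (δ * waitingTime U S k ω)) * S k ω) (i2.const_mul (δ * (c * L + 1)))
      (Eventually.of_forall fun ω => ?_)
    · rw [integral_sub d1 j1, integral_sub (hiΦ' k) (hiΦ k), e1, integral_const_mul, e2,
        Real.norm_eq_abs, mul_comm _ b] at key
      exact key
    · rw [Real.norm_eq_abs]
      set w := waitingTime U S k ω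
      set s := S k ω
      have h1 := hγ.abs_taylor_le (δ * w) (δ * s)
      have h2 := hγ.abs_scaledPrimitive_sub_le hδ.le w s
      have h3 : |c / δ * (γ (δ * w + δ * s) - γ (δ * w) - δ * s * γ₁ (δ * w))|
          ≤ c / δ * (L * (δ * s) ^ 2) := by
        rw [abs_mul, abs_of_nonneg (by positivity : 0 ≤ c / δ)]
        exact mul_le_mul_of_nonneg_left h1 (by positivity)
      have e : Φ (w + s) - Φ w - (c * γ₁ (δ * w) - γ (δ * w)) * s
          = c / δ * (γ (δ * w + δ * s) - γ (δ * w) - δ * s * γ₁ (δ * w))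
            - (scaledPrimitive γ δ (w + s) - scaledPrimitive γ δ w - s * γ (δ * w)) := by
        simp only [hΦ, mul_add]
        field_simp
        ring
      rw [e]
      refine (abs_sub _ _).trans ((add_le_add h3 h2).trans (le_of_eq ?_))
      field_simp
  induction n with
  | zero => simp [scaledPrimitive, hγ.zero]
  | succ n ih =>
    rw [Finset.sum_range_succ, Finset.sum_range_succ, Finset.sum_range_succ, hpath n]
    have := (abs_add_le _ _).trans (add_le_add ih (hstep n))
    push_cast
    refine le_of_eq_of_le ?_ (this.trans (le_of_eq (by ring)))
    congr 1
    ring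

end IsQueue

/-! ### Passage to the limit in the Stein identity -/

namespace IsQueue

variable {Ω Ω' : Type*} [MeasurableSpace Ω] [MeasurableSpace Ω'] {P : Measure Ω}
  [IsProbabilityMeasure P] {P' : Measure Ω'} [IsProbabilityMeasure P']
  {U S : ℕ → Ω → ℝ} {X : Ω' → ℝ} {γ γ₁ : ℝ → ℝ} {L B c K : ℝ}

/-- The limiting distribution almost satisfies the Stein identity of the exponential law. -/
lemma abs_integral_limit_le (h : IsQueue P U S)
    (hX : TendstoInDistribution (scaledWorkload U S P) atTop X (fun _ : ℝ => P) P')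
    (hγ : IsTestFunction γ γ₁ L B) (ha : 0 < ∫ ω, U 0 ω ∂P) (hδ : 0 < 1 - utilization U S P)
    (hc0 : 0 ≤ c)
    (hc : ∫ ω, (S 0 ω - U 0 ω) ^ 2 ∂P = 2 * ((∫ ω, U 0 ω ∂P) * c))
    (hK : ∀ n : ℕ, ∑ k ∈ Finset.range n, ∫ ω, idleTime U S k ω ^ 2 ∂P
      ≤ K * ∑ k ∈ Finset.range n, ∫ ω, idleTime U S k ω ∂P) :
    (∫ ω, U 0 ω ∂P) * |∫ ω, (c * γ₁ (X ω) - γ (X ω)) ∂P'|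
      ≤ (1 - utilization U S P) * (c * ∫ ω, U 0 ω ∂P
        + (∫ ω, S 0 ω ∂P) / (∫ ω, U 0 ω ∂P)
          * (L * ∫ ω, |S 0 ω - U 0 ω| ^ 3 ∂P + K * ∫ ω, U 0 ω ∂P)
        + (c * L + 1) * ∫ ω, S 0 ω ^ 2 ∂P) := by
  have hδdef : 1 - utilization U S P = 1 - (∫ ω, S 0 ω ∂P) / ∫ ω, U 0 ω ∂P := by
    rw [utilization, arrivalRate]; ring
  have hcont : Continuous fun x => c * γ₁ x - γ x := by
    have := hγ.continuous
    have := hγ.continuous_deriv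
    fun_prop
  have hlim := (h.tendsto_average_workload hX hcont (B := c + B) fun x => by
    refine (abs_sub _ _).trans (add_le_add ?_ (hγ.abs_le _))
    rw [abs_mul, abs_of_nonneg hc0]
    exact mul_le_of_le_one_right hc0 (hγ.abs_deriv_le _)).abs
  rw [abs_mul, abs_of_pos ha] at hlim
  set a := ∫ ω, U 0 ω ∂P
  set b := ∫ ω, S 0 ω ∂P
  set δ := 1 - utilization U S P
  have hb : 0 ≤ b := integral_nonneg_of_ae (h.nonneg_S 0)
  have hdrift : ∫ ω, (S 0 ω - U 0 ω) ∂P = -(a * δ) := by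
    rw [integral_sub (h.memLp_S.integrable (by norm_num)) (h.memLp_U.integrable (by norm_num)),
      hδdef]
    field_simp
    ring
  have hw := h.tendsto_integral_waitingTime_div (by rw [hdrift]; nlinarith [mul_pos ha hδ])
  set ξ := ∫ ω, |S 0 ω - U 0 ω| ^ 3 ∂P
  set s₂ := ∫ ω, S 0 ω ^ 2 ∂P
  have hB : 0 ≤ B := (abs_nonneg _).trans (hγ.abs_le 0)
  -- The terms with the bound B of γ vanish in the limit, so B does not enter the final constant;
  -- this later permits test functions without a uniform bound. What survives is a multiple of δ.
  have hR : Tendsto (fun n : ℕ => c / δ * B / n + B * ((∫ ω, waitingTime U S n ω ∂P) / n)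
      + c * ((∫ ω, waitingTime U S n ω ∂P) / n + a * δ)
      + b / (a * δ) * (B * ((∫ ω, waitingTime U S n ω ∂P) / n) + L * δ ^ 2 * ξ
        + δ * (K * ((∫ ω, waitingTime U S n ω ∂P) / n + a * δ)))
      + δ * (c * L + 1) * s₂) atTop
      (𝓝 (0 + B * 0 + c * (0 + a * δ) + b / (a * δ) * (B * 0 + L * δ ^ 2 * ξ
        + δ * (K * (0 + a * δ))) + δ * (c * L + 1) * s₂)) :=
    ((((tendsto_const_div_atTop_nhds_zero_nat _).add (hw.const_mul B)).add
      ((hw.add_const _).const_mul c)).add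
      ((((hw.const_mul B).add_const _).add
        (((hw.add_const _).const_mul K).const_mul δ)).const_mul _)).add_const _
  refine (le_of_tendsto_of_tendsto hlim hR ?_).trans (le_of_eq ?_)
  · filter_upwards [eventually_gt_atTop 0] with n hn
    have hn : (0 : ℝ) < n := by exact_mod_cast hn
    have hwn : 0 ≤ ∫ ω, waitingTime U S n ω ∂P := integral_nonneg fun ω => waitingTime_nonneg n ω
    have h1 := h.abs_sum_integral_depletion_le hγ hδ hc0 n
    have h2 := h.abs_integral_scaledPrimitive_sub_le hγ hδ.le hdrift hc n
    have h3 := h.sum_integral_idleTime n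
    rw [hdrift] at h3
    have h4 := hK n
    have hΓ : |∫ ω, scaledPrimitive γ δ (waitingTime U S n ω) ∂P|
        ≤ B * ∫ ω, waitingTime U S n ω ∂P := by
      rw [← Real.norm_eq_abs, ← integral_const_mul]
      refine norm_integral_le_of_norm_le ((h.integrable_waitingTime n).const_mul B)
        (Eventually.of_forall fun ω => ?_)
      have := hγ.abs_scaledPrimitive_le δ (waitingTime U S n ω)
      rwa [abs_of_nonneg (waitingTime_nonneg n ω)] at this
    have hΦ : |∫ ω, (c / δ * γ (δ * waitingTime U S n ω)
        - scaledPrimitive γ δ (waitingTime U S n ω)) ∂P|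
        ≤ c / δ * B + B * ∫ ω, waitingTime U S n ω ∂P := by
      have e : c / δ * B + B * ∫ ω, waitingTime U S n ω ∂P
          = ∫ ω, (c / δ * B + B * waitingTime U S n ω) ∂P := by
        rw [integral_add (integrable_const _) ((h.integrable_waitingTime n).const_mul B),
          integral_const, probReal_univ, one_smul, integral_const_mul]
      rw [← Real.norm_eq_abs, e]
      refine norm_integral_le_of_norm_le ((integrable_const _).add
        ((h.integrable_waitingTime n).const_mul B)) (Eventually.of_forall fun ω => ?_)
      have := hγ.abs_scaledPrimitive_le δ (waitingTime U S n ω)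
      rw [abs_of_nonneg (waitingTime_nonneg n ω)] at this
      refine (abs_sub _ _).trans (add_le_add ?_ this)
      rw [abs_mul, abs_of_nonneg (by positivity : 0 ≤ c / δ)]
      exact mul_le_mul_of_nonneg_left (hγ.abs_le _) (by positivity)
    set A := ∑ k ∈ Finset.range n, ∫ ω, (∫ r in 0..U k ω,
          (c * γ₁ (δ * max (workAfterArrival U S ω k - r) 0)
            - γ (δ * max (workAfterArrival U S ω k - r) 0))) ∂P
    set Φn := ∫ ω, (c / δ * γ (δ * waitingTime U S n ω)
        - scaledPrimitive γ δ (waitingTime U S n ω)) ∂P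
    set Γn := ∫ ω, scaledPrimitive γ δ (waitingTime U S n ω) ∂P
    set I := ∑ k ∈ Finset.range n, ∫ ω, idleTime U S k ω ∂P
    set I2 := ∑ k ∈ Finset.range n, ∫ ω, idleTime U S k ω ^ 2 ∂P
    set E := ∑ k ∈ Finset.range n,
          ∫ ω, (c * γ₁ (δ * waitingTime U S k ω) - γ (δ * waitingTime U S k ω)) ∂P
    set W := ∫ ω, waitingTime U S n ω ∂P
    have hI0 : 0 ≤ I := Finset.sum_nonneg fun k _ => integral_nonneg fun ω => idleTime_nonneg k ω
    have hIe : I = W + n * (a * δ) := by rw [h3]; ring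
    have haδ : 0 < a * δ := mul_pos ha hδ
    -- The sum E is preceded by aδ, and I itself grows like n a δ, so division by aδ still leaves a
    -- bound of order n δ.
    have hE : a * δ * |E| ≤ B * W + n * (L * δ ^ 2 * ξ) + δ * (K * I) := by
      have e1 : a * δ * |E| = |a * δ * E| := by rw [abs_mul, abs_of_pos haδ]
      have e2 : |a * δ * E| ≤ |Γn| + |Γn - a * δ * E| := by
        have := abs_sub Γn (Γn - a * δ * E)
        rwa [sub_sub_cancel] at this
      have := mul_le_mul_of_nonneg_left h4 hδ.le
      linarith
    have hbE : b * |E| ≤ b / (a * δ) * (B * W + n * (L * δ ^ 2 * ξ) + δ * (K * I)) := by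
      have := mul_le_mul_of_nonneg_left hE (by positivity : 0 ≤ b / (a * δ))
      refine le_of_eq_of_le ?_ this
      field_simp
    have hγI : |c * γ₁ 0 * I| ≤ c * I := by
      rw [abs_mul, abs_mul, abs_of_nonneg hc0, abs_of_nonneg hI0]
      refine mul_le_mul_of_nonneg_right ?_ hI0
      exact mul_le_of_le_one_right hc0 (hγ.abs_deriv_le 0)
    have hA : |A| ≤ n * (δ * (c * L + 1) * s₂) + |Φn| + c * I + b * |E| := by
      have e : A = (A + Φn - c * γ₁ 0 * I - b * E) - Φn + (c * γ₁ 0 * I + b * E) := by ring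
      have e2 : |b * E| = b * |E| := by rw [abs_mul, abs_of_nonneg hb]
      calc |A| ≤ |(A + Φn - c * γ₁ 0 * I - b * E) - Φn| + |c * γ₁ 0 * I + b * E| := by
            conv_lhs => rw [e]
            exact abs_add_le _ _
        _ ≤ (|A + Φn - c * γ₁ 0 * I - b * E| + |Φn|) + (|c * γ₁ 0 * I| + |b * E|) :=
            add_le_add (abs_sub _ _) (abs_add_le _ _)
        _ ≤ _ := by linarith
    rw [abs_div, abs_of_pos hn, div_le_iff₀ hn]
    have hfin : |A| ≤ n * (δ * (c * L + 1) * s₂) + (c / δ * B + B * W) + c * I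
        + b / (a * δ) * (B * W + n * (L * δ ^ 2 * ξ) + δ * (K * I)) := by linarith
    refine hfin.trans (le_of_eq ?_)
    rw [hIe]
    field_simp
    ring
  · field_simp
    ring

/-- The bound for bounded test functions. -/
lemma abs_integral_sub_integral_exp_le_of_bounded (h : IsQueue P U S)
    (hX : TendstoInDistribution (scaledWorkload U S P) atTop X (fun _ : ℝ => P) P')
    (ha : 0 < ∫ ω, U 0 ω ∂P) (hδ : 0 < 1 - utilization U S P)
    (hv : 0 < ∫ ω, (U 0 ω - S 0 ω) ^ 2 ∂P)
    (hK : ∀ n : ℕ, ∑ k ∈ Finset.range n, ∫ ω, idleTime U S k ω ^ 2 ∂P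
      ≤ K * ∑ k ∈ Finset.range n, ∫ ω, idleTime U S k ω ∂P)
    {φ φ' : ℝ → ℝ} (hd : ∀ x, HasDerivAt φ (φ' x) x) (hB : ∀ x, |φ x| ≤ B)
    (h1 : ∀ x, |φ' x| ≤ 1) (h2 : ∀ x y, |φ' x - φ' y| ≤ L * |x - y|) (hm : Measurable φ') :
    (∫ ω, U 0 ω ∂P) * |∫ ω, φ (X ω) ∂P' - ∫ y, φ y ∂(expMeasure (expRate U S P))|
      ≤ (1 - utilization U S P) * ((∫ ω, (U 0 ω - S 0 ω) ^ 2 ∂P) / 2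
        + (∫ ω, S 0 ω ∂P) / (∫ ω, U 0 ω ∂P)
          * (L * ∫ ω, |S 0 ω - U 0 ω| ^ 3 ∂P + K * ∫ ω, U 0 ω ∂P)
        + ((∫ ω, (U 0 ω - S 0 ω) ^ 2 ∂P) / (2 * ∫ ω, U 0 ω ∂P) * L + 1)
          * ∫ ω, S 0 ω ^ 2 ∂P) := by
  have hr : 0 < expRate U S P := by
    rw [expRate, arrivalRate]
    positivity
  have hsymm : ∫ ω, (S 0 ω - U 0 ω) ^ 2 ∂P = ∫ ω, (U 0 ω - S 0 ω) ^ 2 ∂P := by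
    congr 1; ext ω; ring
  -- The mean of the approximating exponential law is exactly the c for which E(S - U)² = 2ac.
  have hcr : 1 / expRate U S P
      = (∫ ω, (U 0 ω - S 0 ω) ^ 2 ∂P) / (2 * ∫ ω, U 0 ω ∂P) := by
    rw [expRate, arrivalRate]
    field_simp
  have hγ : IsTestFunction (steinSol (expRate U S P) φ) (steinSolDeriv (expRate U S P) φ') L
      (2 * B) :=
    { hasDerivAt := hasDerivAt_steinSol hr hd hB h1 hm
      abs_deriv_le := abs_steinSolDeriv_le hr h1
      abs_deriv_sub_le := abs_steinSolDeriv_sub_le hr h1 hm h2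
      abs_le := abs_steinSol_le hr hB
      zero := steinSol_zero }
  have key := h.abs_integral_limit_le hX hγ ha hδ (c := 1 / expRate U S P) (by positivity)
    (by rw [hcr, hsymm]; field_simp) hK
  have hXi : Integrable (fun ω => φ (X ω)) P' := by
    have hc : Continuous φ := continuous_iff_continuousAt.2 fun x => (hd x).continuousAt
    exact Integrable.of_bound
      (hc.measurable.comp_aemeasurable hX.aemeasurable_limit).aestronglyMeasurable B
      (Eventually.of_forall fun ω => hB _)
  simp_rw [stein_equation hr hd hB h1 hm] at key
  rw [integral_sub hXi (integrable_const _), integral_const, probReal_univ, one_smul, hcr] at key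
  refine key.trans (le_of_eq ?_)
  field_simp

end IsQueue

/-- The constant of the error bounds in terms of an upper bound `η` of the hazard rate, the moments
`u₁, u₂, u₃` of the interarrival times and the moments `s₁, s₂, s₃` of the service times. -/
noncomputable def errorConst (η u₁ u₂ u₃ s₁ s₂ s₃ : ℝ) : ℝ :=
  ((u₂ + s₂) / 2 + (2 * (u₃ + s₃) + 2 * (u₂ + u₃) * Real.exp (η * (2 * s₁ + 3)) * u₁)
    + ((u₂ + s₂) / (2 * u₁) * 2 + 1) * s₂) / u₁

/-! ### The bound with an explicit constant -/

section Setting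

variable {Ω Ω' : Type*} [MeasurableSpace Ω] [MeasurableSpace Ω']
  {P : Measure Ω} [IsProbabilityMeasure P] {P' : Measure Ω'} [IsProbabilityMeasure P']
  {U S : ℕ → Ω → ℝ} {g : ℝ → ℝ} {X : Ω' → ℝ}

/-- The constant of the error bounds for a given queue. -/
noncomputable def queueConst (P : Measure Ω) (U S : ℕ → Ω → ℝ) (g : ℝ → ℝ) : ℝ :=
  errorConst (hazardSup P (U 0) g) (∫ ω, U 0 ω ∂P) (∫ ω, U 0 ω ^ 2 ∂P) (∫ ω, U 0 ω ^ 3 ∂P)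
    (∫ ω, S 0 ω ∂P) (∫ ω, S 0 ω ^ 2 ∂P) (∫ ω, S 0 ω ^ 3 ∂P)

namespace Setting

lemma integral_U_pos (hs : Setting P P' U S g X) : 0 < ∫ ω, U 0 ω ∂P := by
  have h := hs.isQueue
  rw [integral_pos_iff_support_of_nonneg_ae (h.nonneg_U 0) (h.integrable_interarrival 0)]
  rw [pos_iff_ne_zero]
  intro h0
  have h1 := hs.isDensity.measure_eq_zero (h.measurable_U 0) 0
  have : P Set.univ = 0 := by
    refine measure_mono_null (fun ω _ => ?_) (measure_union_null h0 h1)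
    by_cases hω : U 0 ω = 0
    · exact Or.inr hω
    · exact Or.inl hω
  simp at this

lemma one_sub_utilization_pos (hs : Setting P P' U S g X) : 0 < 1 - utilization U S P :=
  sub_pos.2 hs.utilization_lt_one

lemma integral_S_lt (hs : Setting P P' U S g X) : ∫ ω, S 0 ω ∂P < ∫ ω, U 0 ω ∂P := by
  have h := hs.utilization_lt_one
  have ha := hs.integral_U_pos
  rwa [utilization, arrivalRate, one_div_mul_eq_div, div_lt_one ha] at h

/-- Since ρ < 1, the mean of U - S is positive, and the second moment dominates its square. -/
lemma integral_sub_sq_pos (hs : Setting P P' U S g X) : 0 < ∫ ω, (U 0 ω - S 0 ω) ^ 2 ∂P := by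
  have h := hs.isQueue
  have hm : MemLp (fun ω => U 0 ω - S 0 ω) 2 P :=
    (h.memLp_U.sub h.memLp_S).mono_exponent (by norm_num)
  have hvar := variance_nonneg (fun ω => U 0 ω - S 0 ω) P
  rw [variance_eq_sub hm] at hvar
  have hmean : ∫ ω, (U 0 ω - S 0 ω) ∂P = ∫ ω, U 0 ω ∂P - ∫ ω, S 0 ω ∂P :=
    integral_sub (h.memLp_U.integrable (by norm_num)) (h.memLp_S.integrable (by norm_num))
  have hpos : 0 < ∫ ω, (U 0 ω - S 0 ω) ∂P := by
    rw [hmean]; exact sub_pos.2 hs.integral_S_lt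
  have : (∫ ω, (U 0 ω - S 0 ω) ∂P) ^ 2 ≤ ∫ ω, (U 0 ω - S 0 ω) ^ 2 ∂P := sub_nonneg.1 hvar
  exact (pow_pos hpos 2).trans_le this

lemma expRate_pos (hs : Setting P P' U S g X) : 0 < expRate U S P := by
  have h1 := hs.integral_U_pos
  have h2 := hs.integral_sub_sq_pos
  rw [expRate, arrivalRate]
  positivity

/-- The bound for bounded test functions with a `2`-Lipschitz derivative. -/
lemma abs_integral_sub_le_of_bounded (hs : Setting P P' U S g X) {B : ℝ} {φ φ' : ℝ → ℝ}
    (hd : ∀ x, HasDerivAt φ (φ' x) x) (hB : ∀ x, |φ x| ≤ B) (h1 : ∀ x, |φ' x| ≤ 1)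
    (h2 : ∀ x y, |φ' x - φ' y| ≤ 2 * |x - y|) (hm : Measurable φ') :
    |∫ ω, φ (X ω) ∂P' - ∫ y, φ y ∂(expMeasure (expRate U S P))|
      ≤ (1 - utilization U S P) * queueConst P U S g := by
  have h := hs.isQueue
  have ha := hs.integral_U_pos
  have hδ := hs.one_sub_utilization_pos
  have hb : 0 ≤ ∫ ω, S 0 ω ∂P := integral_nonneg_of_ae (h.nonneg_S 0)
  have hη := hs.isDensity.exp_neg_le_survival (h.measurable_U 0) (h.nonneg_U 0)
    hs.bddAbove_hazardRate (by positivity : 0 ≤ 2 * ∫ ω, S 0 ω ∂P + 3)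
  have key := h.abs_integral_sub_integral_exp_le_of_bounded hs.limit_law ha hδ
    hs.integral_sub_sq_pos (h.sum_integral_idleTime_sq_le hη) hd hB h1 h2 hm
  have hv : ∫ ω, (U 0 ω - S 0 ω) ^ 2 ∂P ≤ ∫ ω, U 0 ω ^ 2 ∂P + ∫ ω, S 0 ω ^ 2 ∂P := by
    rw [← integral_add (h.integrable_U_pow (by norm_num)) (h.integrable_S_pow (by norm_num))]
    refine integral_mono_ae
      ((h.memLp_U.sub h.memLp_S).mono_exponent (p := 2) (by norm_num)).integrable_sq
      ((h.integrable_U_pow (by norm_num)).add (h.integrable_S_pow (by norm_num))) ?_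
    filter_upwards [h.nonneg_pair 0] with ω hω
    nlinarith [mul_nonneg hω.1 hω.2]
  have hξ : ∫ ω, |S 0 ω - U 0 ω| ^ 3 ∂P ≤ ∫ ω, U 0 ω ^ 3 ∂P + ∫ ω, S 0 ω ^ 3 ∂P := by
    rw [← integral_add h.integrable_U h.integrable_S]
    refine integral_mono_ae h.integrable_abs_sub_pow_three
      (h.integrable_U.add h.integrable_S) ?_
    filter_upwards [h.nonneg_pair 0] with ω hω
    have hU := pow_nonneg hω.1 3
    have hS := pow_nonneg hω.2 3
    rcases le_total (S 0 ω) (U 0 ω) with hle | hle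
    · rw [abs_of_nonpos (by linarith)]
      have : (-(S 0 ω - U 0 ω)) ^ 3 ≤ U 0 ω ^ 3 :=
        pow_le_pow_left₀ (by linarith) (by linarith [hω.2]) 3
      linarith
    · rw [abs_of_nonneg (by linarith)]
      have : (S 0 ω - U 0 ω) ^ 3 ≤ S 0 ω ^ 3 :=
        pow_le_pow_left₀ (by linarith) (by linarith [hω.1]) 3
      linarith
  have hba : (∫ ω, S 0 ω ∂P) / (∫ ω, U 0 ω ∂P) ≤ 1 := (div_le_one ha).2 hs.integral_S_lt.le
  have hu2 : 0 ≤ ∫ ω, U 0 ω ^ 2 ∂P := integral_nonneg fun ω => sq_nonneg _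
  have hs2 : 0 ≤ ∫ ω, S 0 ω ^ 2 ∂P := integral_nonneg fun ω => sq_nonneg _
  have hu3 : 0 ≤ ∫ ω, U 0 ω ^ 3 ∂P :=
    integral_nonneg_of_ae ((h.nonneg_U 0).mono fun ω hω => pow_nonneg hω 3)
  have hs3 : 0 ≤ ∫ ω, S 0 ω ^ 3 ∂P :=
    integral_nonneg_of_ae ((h.nonneg_S 0).mono fun ω hω => pow_nonneg hω 3)
  have hξ0 : 0 ≤ ∫ ω, |S 0 ω - U 0 ω| ^ 3 ∂P := integral_nonneg fun ω => by positivity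
  -- The constant arises from L = 2 and the idle time constant K, after E(U - S)² and E|S - U|³ are
  -- replaced by sums of moments (the variables are nonnegative) and b/a by 1.
  rw [queueConst, errorConst, ← mul_div_assoc, le_div_iff₀ ha, mul_comm]
  refine key.trans (mul_le_mul_of_nonneg_left ?_ hδ.le)
  gcongr ?_ + ?_ + ?_
  · linarith
  · refine (mul_le_of_le_one_left (by positivity) hba).trans ?_
    gcongr
  · gcongr

end Setting

end Setting

/-! ### Smooth truncation of unbounded test functions -/

section Truncation

lemma abs_arctan_le (x : ℝ) : |Real.arctan x| ≤ |x| := by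
  have := abs_sub_le_of_abs_deriv_le (a := x) (K := 1) (fun s => Real.hasDerivAt_arctan s)
    fun s _ => by
      rw [abs_of_nonneg (by positivity), div_le_one (by positivity)]
      linarith [sq_nonneg s]
  simpa using this

/-- A smooth truncation of a function at the level of order `n + 1`. -/
noncomputable def truncate (h : ℝ → ℝ) (n : ℕ) (x : ℝ) : ℝ :=
  ((n : ℝ) + 1) * Real.arctan (h x / ((n : ℝ) + 1))

variable {h h' h'' : ℝ → ℝ}

lemma abs_truncate_le (h : ℝ → ℝ) (n : ℕ) (x : ℝ) : |truncate h n x| ≤ |h x| := by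
  have hn : (0 : ℝ) < (n : ℝ) + 1 := by positivity
  rw [truncate, abs_mul, abs_of_pos hn]
  refine (mul_le_mul_of_nonneg_left (abs_arctan_le _) hn.le).trans (le_of_eq ?_)
  rw [abs_div, abs_of_pos hn]
  field_simp

lemma abs_truncate_le_const (h : ℝ → ℝ) (n : ℕ) (x : ℝ) :
    |truncate h n x| ≤ ((n : ℝ) + 1) * (Real.pi / 2) := by
  have hn : (0 : ℝ) < (n : ℝ) + 1 := by positivity
  rw [truncate, abs_mul, abs_of_pos hn]
  exact mul_le_mul_of_nonneg_left
    (abs_le.2 ⟨(Real.neg_pi_div_two_lt_arctan _).le, (Real.arctan_lt_pi_div_two _).le⟩) hn.le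

lemma truncate_nonneg (hh : ∀ x, 0 ≤ h x) (n : ℕ) (x : ℝ) : 0 ≤ truncate h n x :=
  mul_nonneg (by positivity) (Real.arctan_nonneg.2 (div_nonneg (hh x) (by positivity)))

/-- The truncated values are difference quotients at 0 of t ↦ arctan(h(x) t), whose derivative there
is h(x). -/
lemma tendsto_truncate (h : ℝ → ℝ) (x : ℝ) :
    Tendsto (fun n => truncate h n x) atTop (𝓝 (h x)) := by
  have hd : HasDerivAt (fun t => Real.arctan (h x * t)) (h x) 0 := by
    refine ((hasDerivAt_id (0 : ℝ)).const_mul (h x)).arctan.congr_deriv ?_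
    simp
  have hlim : Tendsto (fun n : ℕ => 1 / ((n : ℝ) + 1)) atTop (𝓝[≠] 0) :=
    tendsto_nhdsWithin_iff.2 ⟨tendsto_one_div_add_atTop_nhds_zero_nat,
      Eventually.of_forall fun n => (by positivity : (1 : ℝ) / ((n : ℝ) + 1) ≠ 0)⟩
  refine (hd.tendsto_slope_zero.comp hlim).congr fun n => ?_
  simp [truncate, div_eq_mul_inv]

/-- The derivative of the smooth truncation. -/
noncomputable def truncateDeriv (h h' : ℝ → ℝ) (n : ℕ) (x : ℝ) : ℝ :=
  h' x / (1 + (h x / ((n : ℝ) + 1)) ^ 2)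

lemma hasDerivAt_truncate (h1 : ∀ x, HasDerivAt h (h' x) x) (n : ℕ) (x : ℝ) :
    HasDerivAt (truncate h n) (truncateDeriv h h' n x) x := by
  refine (((h1 x).div_const ((n : ℝ) + 1)).arctan.const_mul ((n : ℝ) + 1)).congr_deriv ?_
  rw [truncateDeriv]
  field_simp

lemma abs_truncateDeriv_le (hb : ∀ x, |h' x| ≤ 1) (n : ℕ) (x : ℝ) :
    |truncateDeriv h h' n x| ≤ 1 := by
  rw [truncateDeriv, abs_div, abs_of_pos (by positivity : 0 < 1 + (h x / ((n : ℝ) + 1)) ^ 2),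
    div_le_one (by positivity)]
  linarith [hb x, sq_nonneg (h x / ((n : ℝ) + 1))]

/-- With y = h/N the second derivative consists of h''/(1 + y²) and 2 y h'²/(N (1 + y²)²). Each is
at most 1 in absolute value, the latter because 2|y| ≤ 1 + y² and N ≥ 1. Hence the Lipschitz
constant 2, independent of n. -/
lemma abs_truncateDeriv_sub_le (h1 : ∀ x, HasDerivAt h (h' x) x)
    (h2 : ∀ x, HasDerivAt h' (h'' x) x) (hb1 : ∀ x, |h' x| ≤ 1) (hb2 : ∀ x, |h'' x| ≤ 1)
    (n : ℕ) (x y : ℝ) :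
    |truncateDeriv h h' n x - truncateDeriv h h' n y| ≤ 2 * |x - y| := by
  set N : ℝ := (n : ℝ) + 1
  have hN : 1 ≤ N := by simp [N]
  have hd (z : ℝ) : HasDerivAt (truncateDeriv h h' n)
      ((h'' z * (1 + (h z / N) ^ 2) - h' z * (2 * (h z / N) * (h' z / N)))
        / (1 + (h z / N) ^ 2) ^ 2) z := by
    refine ((h2 z).div ((((h1 z).div_const N).pow 2).const_add 1)
      (show 1 + (h z / N) ^ 2 ≠ 0 by positivity)).congr_deriv ?_
    simp
  have hb (z : ℝ) : |(h'' z * (1 + (h z / N) ^ 2) - h' z * (2 * (h z / N) * (h' z / N)))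
        / (1 + (h z / N) ^ 2) ^ 2| ≤ 2 := by
    set y := h z / N
    have hy : 0 < 1 + y ^ 2 := by positivity
    rw [abs_div, abs_of_pos (by positivity : 0 < (1 + y ^ 2) ^ 2), div_le_iff₀ (by positivity)]
    have e1 : |h'' z * (1 + y ^ 2)| ≤ 1 + y ^ 2 := by
      rw [abs_mul, abs_of_pos hy]
      exact mul_le_of_le_one_left hy.le (hb2 z)
    have e2 : |h' z * (2 * y * (h' z / N))| ≤ 1 + y ^ 2 := by
      have hN' : |h' z / N| ≤ 1 := by
        rw [abs_div, abs_of_pos (by linarith : 0 < N), div_le_one (by linarith)]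
        exact (hb1 z).trans hN
      have hy2 : |2 * y| ≤ 1 + y ^ 2 := by
        rw [abs_mul, abs_two, ← sq_abs y]
        nlinarith [sq_nonneg (|y| - 1)]
      rw [abs_mul, abs_mul]
      calc |h' z| * (|2 * y| * |h' z / N|) ≤ 1 * ((1 + y ^ 2) * 1) :=
            mul_le_mul (hb1 z) (mul_le_mul hy2 hN' (abs_nonneg _) hy.le) (by positivity)
              zero_le_one
        _ = 1 + y ^ 2 := by ring
    refine (abs_sub _ _).trans ((add_le_add e1 e2).trans ?_)
    nlinarith [sq_nonneg y]
  have := abs_sub_le_of_abs_deriv_le (F := fun s => truncateDeriv h h' n (y + s))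
    (a := x - y) (K := 2) (fun s => HasDerivAt.comp_const_add y s (hd (y + s))) fun s _ => hb _
  simpa using this

lemma tendsto_integral_truncate {α : Type*} [MeasurableSpace α] {μ : Measure α} {Z : α → ℝ}
    (hc : Continuous h) (hZ : AEMeasurable Z μ) (hi : Integrable (fun ω => h (Z ω)) μ) :
    Tendsto (fun n => ∫ ω, truncate h n (Z ω) ∂μ) atTop (𝓝 (∫ ω, h (Z ω) ∂μ)) := by
  refine tendsto_integral_of_dominated_convergence (fun ω => |h (Z ω)|) (fun n => ?_) hi.abs
    (fun n => Eventually.of_forall fun ω => abs_truncate_le h n (Z ω))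
    (Eventually.of_forall fun ω => tendsto_truncate h (Z ω))
  have : Continuous (truncate h n) := by unfold truncate; fun_prop
  exact (this.measurable.comp_aemeasurable hZ).aestronglyMeasurable

lemma abs_le_add_abs_of_abs_deriv_le (h1 : ∀ x, HasDerivAt h (h' x) x) (hb : ∀ x, |h' x| ≤ 1)
    (x : ℝ) : |h x| ≤ |h 0| + |x| := by
  have := abs_sub_le_of_abs_deriv_le h1 (a := x) (K := 1) fun s _ => hb s
  have h2 := abs_sub_abs_le_abs_sub (h x) (h 0)
  linarith

end Truncation

/-- Fatou's lemma. -/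
lemma integrable_of_tendsto_of_integral_le {α : Type*} [MeasurableSpace α] {μ : Measure α}
    {f : ℕ → α → ℝ} {F : α → ℝ} {D : ℝ} (hf : ∀ n, Integrable (f n) μ) (h0 : ∀ n ω, 0 ≤ f n ω)
    (hlim : ∀ ω, Tendsto (fun n => f n ω) atTop (𝓝 (F ω))) (hD : ∀ n, ∫ ω, f n ω ∂μ ≤ D) :
    Integrable F μ := by
  refine ⟨aestronglyMeasurable_of_tendsto_ae atTop (fun n => (hf n).aestronglyMeasurable)
    (Eventually.of_forall hlim), ?_⟩
  have hF (ω : α) : 0 ≤ F ω := ge_of_tendsto' (hlim ω) fun n => h0 n ω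
  rw [hasFiniteIntegral_iff_ofReal (Eventually.of_forall hF)]
  have hle : ∫⁻ ω, ENNReal.ofReal (F ω) ∂μ
      ≤ liminf (fun n => ∫⁻ ω, ENNReal.ofReal (f n ω) ∂μ) atTop := by
    refine le_trans (le_of_eq ?_)
      (lintegral_liminf_le' fun n => (hf n).aestronglyMeasurable.aemeasurable.ennreal_ofReal)
    refine lintegral_congr fun ω => ?_
    exact (((ENNReal.continuous_ofReal.tendsto _).comp (hlim ω)).liminf_eq).symm
  refine hle.trans_lt (lt_of_le_of_lt ?_ (ENNReal.ofReal_lt_top (r := D)))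
  refine liminf_le_of_le (by isBoundedDefault) fun b hb => ?_
  obtain ⟨n, hn⟩ := hb.exists
  refine hn.trans ?_
  rw [← ofReal_integral_eq_lintegral_ofReal (hf n) (Eventually.of_forall (h0 n))]
  exact ENNReal.ofReal_le_ofReal (hD n)

/-! ### Unbounded test functions and the mean of the limit -/

namespace Setting

variable {Ω Ω' : Type*} [MeasurableSpace Ω] [MeasurableSpace Ω']
  {P : Measure Ω} [IsProbabilityMeasure P] {P' : Measure Ω'} [IsProbabilityMeasure P']
  {U S : ℕ → Ω → ℝ} {g : ℝ → ℝ} {X : Ω' → ℝ} {h h' h'' : ℝ → ℝ}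

lemma abs_integral_truncate_sub_le (hs : Setting P P' U S g X)
    (h1 : ∀ x, HasDerivAt h (h' x) x) (h2 : ∀ x, HasDerivAt h' (h'' x) x)
    (hb1 : ∀ x, |h' x| ≤ 1) (hb2 : ∀ x, |h'' x| ≤ 1) (n : ℕ) :
    |∫ ω, truncate h n (X ω) ∂P' - ∫ y, truncate h n y ∂(expMeasure (expRate U S P))|
      ≤ (1 - utilization U S P) * queueConst P U S g := by
  have hc : Continuous h := continuous_iff_continuousAt.2 fun x => (h1 x).continuousAt
  have hc' : Continuous h' := continuous_iff_continuousAt.2 fun x => (h2 x).continuousAt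
  refine hs.abs_integral_sub_le_of_bounded (hasDerivAt_truncate h1 n)
    (abs_truncate_le_const h n) (abs_truncateDeriv_le hb1 n)
    (abs_truncateDeriv_sub_le h1 h2 hb1 hb2 n) ?_
  exact hc'.measurable.div (((hc.measurable.div_const _).pow_const 2).const_add 1)

lemma integrable_comp_exp (hs : Setting P P' U S g X)
    (h1 : ∀ x, HasDerivAt h (h' x) x) (hb1 : ∀ x, |h' x| ≤ 1) :
    Integrable h (expMeasure (expRate U S P)) := by
  have := isProbabilityMeasure_expMeasure hs.expRate_pos
  have hc : Continuous h := continuous_iff_continuousAt.2 fun x => (h1 x).continuousAt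
  exact ((integrable_const |h 0|).add (integrable_id_expMeasure hs.expRate_pos).abs).mono'
    hc.aestronglyMeasurable (Eventually.of_forall fun x => abs_le_add_abs_of_abs_deriv_le h1 hb1 x)

/-- The function √(1 + x²) is a smooth majorant of |x| with first two derivatives bounded by 1. Its
truncations have means under X bounded by the mean under the exponential law plus the error bound,
uniformly in n, so Fatou's lemma applies. -/
lemma integrable_limit (hs : Setting P P' U S g X) : Integrable X P' := by
  have hX : AEMeasurable X P' := hs.limit_law.aemeasurable_limit
  set φ : ℝ → ℝ := fun x => √(1 + x ^ 2)
  have hpos (x : ℝ) : 0 < 1 + x ^ 2 := by positivity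
  have hφpos (x : ℝ) : 0 < φ x := Real.sqrt_pos.2 (hpos x)
  have hφsq (x : ℝ) : φ x ^ 2 = 1 + x ^ 2 := Real.sq_sqrt (hpos x).le
  have hle (x : ℝ) : |x| ≤ φ x := Real.le_sqrt_of_sq_le (by rw [sq_abs]; linarith)
  have hone (x : ℝ) : 1 ≤ φ x := Real.one_le_sqrt.2 (by linarith [sq_nonneg x])
  have h1 (x : ℝ) : HasDerivAt φ (x / φ x) x := by
    refine (((hasDerivAt_pow 2 x).const_add 1).sqrt (hpos x).ne').congr_deriv ?_
    have := (hφpos x).ne'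
    simp only [φ] at this ⊢
    field_simp
    simp
  have h2 (x : ℝ) : HasDerivAt (fun x => x / φ x) (1 / φ x ^ 3) x := by
    refine ((hasDerivAt_id x).div (h1 x) (hφpos x).ne').congr_deriv ?_
    have := (hφpos x).ne'
    simp only [id]
    field_simp
    linarith [hφsq x]
  have hb1 (x : ℝ) : |x / φ x| ≤ 1 := by
    rw [abs_div, abs_of_pos (hφpos x), div_le_one (hφpos x)]
    exact hle x
  have hb2 (x : ℝ) : |1 / φ x ^ 3| ≤ 1 := by
    have := hφpos x
    rw [abs_of_pos (by positivity), div_le_one (by positivity)]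
    exact one_le_pow₀ (hone x)
  have hiY := hs.integrable_comp_exp h1 hb1
  have := isProbabilityMeasure_expMeasure hs.expRate_pos
  have htc (n : ℕ) : Continuous (truncate φ n) :=
    continuous_iff_continuousAt.2 fun x => (hasDerivAt_truncate h1 n x).continuousAt
  have hφX : Integrable (fun ω => φ (X ω)) P' := by
    refine integrable_of_tendsto_of_integral_le (f := fun n ω => truncate φ n (X ω))
      (D := ∫ y, φ y ∂(expMeasure (expRate U S P))
        + (1 - utilization U S P) * queueConst P U S g) (fun n => ?_)
      (fun n ω => truncate_nonneg (fun x => (hφpos x).le) n _)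
      (fun ω => tendsto_truncate φ (X ω)) fun n => ?_
    · exact Integrable.of_bound ((htc n).measurable.comp_aemeasurable hX).aestronglyMeasurable
        (((n : ℝ) + 1) * (Real.pi / 2)) (Eventually.of_forall fun ω => abs_truncate_le_const φ n _)
    · have hn := (abs_le.1 (hs.abs_integral_truncate_sub_le h1 h2 hb1 hb2 n)).2
      have hY : ∫ y, truncate φ n y ∂(expMeasure (expRate U S P))
          ≤ ∫ y, φ y ∂(expMeasure (expRate U S P)) := by
        refine integral_mono_of_nonneg
          (Eventually.of_forall fun x => truncate_nonneg (fun x => (hφpos x).le) n x) hiY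
          (Eventually.of_forall fun x => ?_)
        have := (le_abs_self _).trans (abs_truncate_le φ n x)
        rwa [abs_of_pos (hφpos x)] at this
      linarith
  exact hφX.mono' hX.aestronglyMeasurable (Eventually.of_forall fun ω => hle _)

/-- The bound for the truncations is uniform in the level. As h grows at most linearly and both laws
have a first moment, dominated convergence removes the truncation. -/
theorem abs_integral_sub_le (hs : Setting P P' U S g X)
    (h1 : ∀ x, HasDerivAt h (h' x) x) (h2 : ∀ x, HasDerivAt h' (h'' x) x)
    (hb1 : ∀ x, |h' x| ≤ 1) (hb2 : ∀ x, |h'' x| ≤ 1) :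
    |∫ ω, h (X ω) ∂P' - ∫ y, h y ∂(expMeasure (expRate U S P))|
      ≤ (1 - utilization U S P) * queueConst P U S g := by
  have hX : AEMeasurable X P' := hs.limit_law.aemeasurable_limit
  have hc : Continuous h := continuous_iff_continuousAt.2 fun x => (h1 x).continuousAt
  have hiX : Integrable (fun ω => h (X ω)) P' :=
    ((integrable_const |h 0|).add hs.integrable_limit.abs).mono'
      (hc.measurable.comp_aemeasurable hX).aestronglyMeasurable
      (Eventually.of_forall fun ω => abs_le_add_abs_of_abs_deriv_le h1 hb1 _)
  have hiY := hs.integrable_comp_exp h1 hb1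
  exact le_of_tendsto' ((tendsto_integral_truncate hc hX hiX).sub
    (tendsto_integral_truncate hc aemeasurable_id hiY)).abs
    fun n => hs.abs_integral_truncate_sub_le h1 h2 hb1 hb2 n

lemma abs_integral_limit_sub_le (hs : Setting P P' U S g X) :
    |∫ ω, X ω ∂P' - ∫ y, y ∂(expMeasure (expRate U S P))|
      ≤ (1 - utilization U S P) * queueConst P U S g :=
  hs.abs_integral_sub_le (h := fun x => x) (h' := fun _ => 1) (h'' := fun _ => 0)
    (fun x => hasDerivAt_id x) (fun x => hasDerivAt_const x 1) (by simp) (by simp)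

lemma abs_integral_sub_le_of_mem_smoothClass (hs : Setting P P' U S g X)
    (hh : h ∈ smoothClass 3) :
    |∫ ω, h (X ω) ∂P' - ∫ y, h y ∂(expMeasure (expRate U S P))|
      ≤ (1 - utilization U S P) * queueConst P U S g := by
  obtain ⟨hd, hb⟩ := hh
  have h1 (x : ℝ) : HasDerivAt h (iteratedDeriv 1 h x) x := by
    have := (hd 0 (by norm_num) x).hasDerivAt
    rwa [iteratedDeriv_zero, ← iteratedDeriv_one] at this
  have h2 (x : ℝ) : HasDerivAt (iteratedDeriv 1 h) (iteratedDeriv 2 h x) x := by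
    have := (hd 1 (by norm_num) x).hasDerivAt
    rwa [← iteratedDeriv_succ] at this
  exact hs.abs_integral_sub_le h1 h2 (hb 1 (by norm_num) (by norm_num))
    (hb 2 (by norm_num) (by norm_num))

end Setting

/-! ### The constants as functions of the moments, and the theorem -/

lemma continuousOn_errorConst {α : Type*} [TopologicalSpace α] {s : Set α}
    {η u₁ u₂ u₃ s₁ s₂ s₃ : α → ℝ} (hη : Continuous η) (hu₁ : Continuous u₁) (hu₂ : Continuous u₂)
    (hu₃ : Continuous u₃) (hs₁ : Continuous s₁) (hs₂ : Continuous s₂) (hs₃ : Continuous s₃)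
    (h : ∀ p ∈ s, 0 < u₁ p) :
    ContinuousOn (fun p => errorConst (η p) (u₁ p) (u₂ p) (u₃ p) (s₁ p) (s₂ p) (s₃ p)) s := by
  unfold errorConst
  -- The only denominators are u₁ and 2 u₁.
  have h1 : ∀ p ∈ s, u₁ p ≠ 0 := fun p hp => (h p hp).ne'
  have h2 : ∀ p ∈ s, 2 * u₁ p ≠ 0 := fun p hp => mul_ne_zero two_ne_zero (h1 p hp)
  have h3 : ContinuousOn (fun p => (u₂ p + s₂ p) / (2 * u₁ p)) s :=
    (hu₂.add hs₂).continuousOn.div (continuous_const.mul hu₁).continuousOn h2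
  refine ContinuousOn.div ?_ hu₁.continuousOn h1
  refine ContinuousOn.add (Continuous.continuousOn (by fun_prop)) ?_
  exact ((h3.mul continuousOn_const).add continuousOn_const).mul hs₂.continuousOn

/-- The constant as a function of the vectors of moments. -/
noncomputable def momentConst (η : ℝ) (u s : Fin 3 → ℝ) : ℝ :=
  errorConst η (u 0) (u 1) (u 2) (s 0) (s 1) (s 2)

lemma momentConst_moments {Ω : Type*} [MeasurableSpace Ω] (P : Measure Ω) (U S : ℕ → Ω → ℝ)
    (g : ℝ → ℝ) :
    momentConst (hazardSup P (U 0) g) (moments P (U 0) 3) (moments P (S 0) 3)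
      = queueConst P U S g := by
  simp [momentConst, queueConst, moments, moment]

end GG1

theorem theorem2 :
    -- (a) nonincreasing hazard rate; the arguments of the constants stand for
    -- the supremum of the hazard rate, the moments of `U` and the moments of `S`
    (∃ (C₃ C₃' : ℝ × (Fin 3 → ℝ) × (Fin 3 → ℝ) → ℝ) (C₄' : ℝ × (Fin 3 → ℝ) × (Fin 4 → ℝ) → ℝ),
      ContinuousOn C₃ {p | 0 < p.1 ∧ (∀ i, 0 < p.2.1 i) ∧ ∀ i, 0 < p.2.2 i} ∧
      ContinuousOn C₃' {p | 0 < p.1 ∧ (∀ i, 0 < p.2.1 i) ∧ ∀ i, 0 < p.2.2 i} ∧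
      ContinuousOn C₄' {p | 0 < p.1 ∧ (∀ i, 0 < p.2.1 i) ∧ ∀ i, 0 < p.2.2 i} ∧
      ∀ (Ω Ω' : Type*) [MeasurableSpace Ω] [MeasurableSpace Ω']
        (P : Measure Ω) [IsProbabilityMeasure P] (P' : Measure Ω') [IsProbabilityMeasure P']
        (U S : ℕ → Ω → ℝ) (g : ℝ → ℝ) (X : Ω' → ℝ),
        GG1.Setting P P' U S g X →
        AntitoneOn (GG1.hazardRate P (U 0) g) (Set.Ici 0) →
        (Integrable X P' ∧
          |∫ ω, X ω ∂P' - ∫ y, y ∂(expMeasure (GG1.expRate U S P))|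
            ≤ (1 - GG1.utilization U S P) *
                C₃ (GG1.hazardSup P (U 0) g, GG1.moments P (U 0) 3, GG1.moments P (S 0) 3)) ∧
        (Integrable (fun ω => S 0 ω ^ 4) P → ∀ h ∈ GG1.smoothClass 3,
          |∫ ω, h (X ω) ∂P' - ∫ y, h y ∂(expMeasure (GG1.expRate U S P))|
            ≤ (1 - GG1.utilization U S P) *
                C₃' (GG1.hazardSup P (U 0) g, GG1.moments P (U 0) 3, GG1.moments P (S 0) 3)
              + (1 - GG1.utilization U S P) ^ 2 *
                C₄' (GG1.hazardSup P (U 0) g, GG1.moments P (U 0) 3, GG1.moments P (S 0) 4))) ∧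
    -- (b) hazard rate bounded below; the first two arguments of the constants stand for
    -- the supremum and the infimum of the hazard rate
    (∃ (C₃ C₃' : ℝ × ℝ × (Fin 3 → ℝ) × (Fin 3 → ℝ) → ℝ)
        (C₄' : ℝ × ℝ × (Fin 3 → ℝ) × (Fin 4 → ℝ) → ℝ),
      ContinuousOn C₃
        {p | 0 < p.1 ∧ 0 < p.2.1 ∧ (∀ i, 0 < p.2.2.1 i) ∧ ∀ i, 0 < p.2.2.2 i} ∧
      ContinuousOn C₃'
        {p | 0 < p.1 ∧ 0 < p.2.1 ∧ (∀ i, 0 < p.2.2.1 i) ∧ ∀ i, 0 < p.2.2.2 i} ∧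
      ContinuousOn C₄'
        {p | 0 < p.1 ∧ 0 < p.2.1 ∧ (∀ i, 0 < p.2.2.1 i) ∧ ∀ i, 0 < p.2.2.2 i} ∧
      ∀ (Ω Ω' : Type*) [MeasurableSpace Ω] [MeasurableSpace Ω']
        (P : Measure Ω) [IsProbabilityMeasure P] (P' : Measure Ω') [IsProbabilityMeasure P']
        (U S : ℕ → Ω → ℝ) (g : ℝ → ℝ) (X : Ω' → ℝ),
        GG1.Setting P P' U S g X →
        0 < GG1.hazardInf P (U 0) g →
        (Integrable X P' ∧
          |∫ ω, X ω ∂P' - ∫ y, y ∂(expMeasure (GG1.expRate U S P))|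
            ≤ (1 - GG1.utilization U S P) *
                C₃ (GG1.hazardSup P (U 0) g, GG1.hazardInf P (U 0) g,
                  GG1.moments P (U 0) 3, GG1.moments P (S 0) 3)) ∧
        (Integrable (fun ω => S 0 ω ^ 4) P → ∀ h ∈ GG1.smoothClass 3,
          |∫ ω, h (X ω) ∂P' - ∫ y, h y ∂(expMeasure (GG1.expRate U S P))|
            ≤ (1 - GG1.utilization U S P) *
                C₃' (GG1.hazardSup P (U 0) g, GG1.hazardInf P (U 0) g,
                  GG1.moments P (U 0) 3, GG1.moments P (S 0) 3)
              + (1 - GG1.utilization U S P) ^ 2 *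
                C₄' (GG1.hazardSup P (U 0) g, GG1.hazardInf P (U 0) g,
                  GG1.moments P (U 0) 3, GG1.moments P (S 0) 4))) := by
  -- One constant, built from the supremum of the hazard rate and three moments, serves for the mean
  -- and for the test functions in both parts. The bound is already linear in 1 - ρ, so the
  -- coefficient of (1 - ρ)² is taken to be 0.
  refine ⟨⟨fun p => GG1.momentConst p.1 p.2.1 p.2.2, fun p => GG1.momentConst p.1 p.2.1 p.2.2,
    fun _ => 0, ?_, ?_, continuousOn_const, ?_⟩,
    ⟨fun p => GG1.momentConst p.1 p.2.2.1 p.2.2.2, fun p => GG1.momentConst p.1 p.2.2.1 p.2.2.2,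
    fun _ => 0, ?_, ?_, continuousOn_const, ?_⟩⟩
  · exact GG1.continuousOn_errorConst (by fun_prop) (by fun_prop) (by fun_prop) (by fun_prop)
      (by fun_prop) (by fun_prop) (by fun_prop) fun p hp => hp.2.1 0
  · exact GG1.continuousOn_errorConst (by fun_prop) (by fun_prop) (by fun_prop) (by fun_prop)
      (by fun_prop) (by fun_prop) (by fun_prop) fun p hp => hp.2.1 0
  · intro Ω Ω' _ _ P _ P' _ U S g X hs _
    simp only [GG1.momentConst_moments, mul_zero, add_zero]
    exact ⟨⟨hs.integrable_limit, hs.abs_integral_limit_sub_le⟩,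
      fun _ h hh => hs.abs_integral_sub_le_of_mem_smoothClass hh⟩
  · exact GG1.continuousOn_errorConst (by fun_prop) (by fun_prop) (by fun_prop) (by fun_prop)
      (by fun_prop) (by fun_prop) (by fun_prop) fun p hp => hp.2.2.1 0
  · exact GG1.continuousOn_errorConst (by fun_prop) (by fun_prop) (by fun_prop) (by fun_prop)
      (by fun_prop) (by fun_prop) (by fun_prop) fun p hp => hp.2.2.1 0
  · intro Ω Ω' _ _ P _ P' _ U S g X hs _
    simp only [GG1.momentConst_moments, mul_zero, add_zero]
    exact ⟨⟨hs.integrable_limit, hs.abs_integral_limit_sub_le⟩,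
      fun _ h hh => hs.abs_integral_sub_le_of_mem_smoothClass hh⟩
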